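/- For $N\ge 1$ particles in the plane write $\mathbf x=(x_1,\dots,x_N)\in(\mathbb R^2)^N=\mathbb R^{2N}$, and for $\alpha\in\mathbb R$ let $$D_j=-i\nabla_{x_j}+\alpha A_j,\qquad A_j(\mathbf x)=\sum_{k\ne j}\frac{(x_j-x_k)^\perp}{|x_j-x_k|^2},\qquad (x,y)^\perp=(-y,x).$$ Let $\mathscr D_\alpha^N\subset L^2_{\mathrm{sym}}(\mathbb R^{2N})$ (the permutation-symmetric square-integrable functions) be the form domain of $\hat T_\alpha=\sum_{j=1}^N D_j^2$ for ideal anyons, i.e. the domain of the closure of the operator $\Psi\mapsto(D_j\Psi)_{j=1}^N$ initially defined on the symmetric functions in $C_c^\infty(\mathbb R^{2N}\setminus\{\mathbf x: x_j=x_k\text{ for some }j\neq k\})$; for $\Psi\in\mathscr D^N_\alpha$ let $D_j\Psi$ denote the components of this closure. The one-body density of $\Psi$ is $$\varrho_\Psi(x)=N\int_{\mathbb R^{2(N-1)}}|\Psi(x,x_2,\dots,x_N)|^2\,dx_2\cdots dx_N .$$ There exists a universal constant $C>0$ such that the following hold. (i) For all $0\le\alpha\le1$, all $N\ge1$ and all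 $\Psi\in\mathscr D_\alpha^N$ with $\int_{\mathbb R^{2N}}|\Psi|^2=1$, $$\sum_{j=1}^N\int_{\mathbb R^{2N}}|D_j\Psi|^2\;\ge\; C\,\alpha\int_{\mathbb R^2}\varrho_\Psi(x)^2\,dx .$$ (ii) With the same $C$, for all $0<\alpha\le1$, all $N\ge1$ and every measurable $V:\mathbb R^2\to\mathbb R$, with $\hat V(\mathbf x)=\sum_{j=1}^N V(x_j)$ and $V_-=\max\{-V,0\}$, the ground-state energy of $\hat T_\alpha+\hat V$, that is $$\inf\Big\{\sum_{j=1}^N\int_{\mathbb R^{2N}}|D_j\Psi|^2+\int_{\mathbb R^{2N}}\hat V|\Psi|^2 \;:\; \Psi\in\mathscr D_\alpha^N,\ \int_{\mathbb R^{2N}}|\Psi|^2=1,\ \int_{\mathbb R^{2N}}|V(x_j)||\Psi|^2<\infty\ \text{for all } j\Big\},$$ is at least $-\dfrac{1}{4C\alpha}\displaystyle\int_{\mathbb R^2}V_-(x)^2\,dx$ (a trivial bound if this integral is infinite). -/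

import Mathlib

open MeasureTheory Filter Topology
open scoped ENNReal ContDiff

noncomputable section

namespace Anyon

/-- The plane `ℝ²` with its Euclidean norm and Lebesgue measure. -/
abbrev Plane : Type := EuclideanSpace ℝ (Fin 2)

/-- Configurations `(x₁, …, x_N)` of `N` particles in the plane, i.e. `ℝ^{2N}`; `volume` is
`2N`-dimensional Lebesgue measure. -/
abbrev Config (N : ℕ) : Type := Fin N → Plane

/-- The Aharonov–Bohm potential `x^{-⊥} = (-y, x) / (x² + y²)` of a flux `2π` at the origin. -/
def perpInv (x : Plane) : Plane := !₂[-(x 1) / ‖x‖ ^ 2, x 0 / ‖x‖ ^ 2]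

/-- The statistics vector potential `A_j = ∑_{k ≠ j} (x_j - x_k)^{-⊥}`. -/
def vectorPotential {N : ℕ} (j : Fin N) (x : Config N) : Plane :=
  ∑ k ∈ Finset.univ.erase j, perpInv (x j - x k)

/-- The partial derivative of `η` in the `a`-th coordinate of the `j`-th particle. -/
def partialDeriv {N : ℕ} (j : Fin N) (a : Fin 2) (η : Config N → ℂ) (x : Config N) : ℂ :=
  fderiv ℝ η x (Pi.single j (EuclideanSpace.single a 1))

/-- The magnetic momentum `D_j η = -i ∇_j η + α A_j η ∈ ℂ²` of a smooth function `η`. -/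
def momentum {N : ℕ} (α : ℝ) (j : Fin N) (η : Config N → ℂ) (x : Config N) :
    EuclideanSpace ℂ (Fin 2) :=
  WithLp.toLp 2 fun a =>
    -Complex.I * partialDeriv j a η x + (α : ℂ) * (vectorPotential j x a : ℂ) * η x

/-- The configurations without coinciding particles. -/
def offDiagonal (N : ℕ) : Set (Config N) := {x | ∀ j k, j ≠ k → x j ≠ x k}

/-- Permutation-symmetric smooth functions with compact support away from the diagonals. -/
structure IsCore {N : ℕ} (η : Config N → ℂ) : Prop where
  smooth : ContDiff ℝ ∞ η
  compact : HasCompactSupport η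
  support : tsupport η ⊆ offDiagonal N
  symmetric : ∀ (σ : Equiv.Perm (Fin N)) (x : Config N), η (x ∘ σ) = η x

/-- `IsMomentum α Ψ D`: the function `Ψ` belongs to the form domain of `N` ideal anyons with
statistics parameter `α` and `D_j Ψ = D j` (almost everywhere) for all `j`. That is, `(Ψ, D)` is in
the graph of the closure, as an operator from the symmetric `L²` functions to `L²`, of the operator
`η ↦ (D_j η)_j` on the symmetric smooth functions with compact support away from the diagonals. -/
structure IsMomentum {N : ℕ} (α : ℝ) (Ψ : Config N → ℂ)
    (D : Fin N → Config N → EuclideanSpace ℂ (Fin 2)) : Prop where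
  memLp : MemLp Ψ 2 volume
  memLp_momentum : ∀ j, MemLp (D j) 2 volume
  approx : ∃ η : ℕ → Config N → ℂ, (∀ m, IsCore (η m)) ∧
    Tendsto (fun m => eLpNorm (η m - Ψ) 2 volume) atTop (𝓝 0) ∧
    ∀ j, Tendsto (fun m => eLpNorm (momentum α j (η m) - D j) 2 volume) atTop (𝓝 0)

/-- The kinetic energy `∑_j ∫_{ℝ^{2N}} |D_j|²`. -/
def kineticEnergy {N : ℕ} (D : Fin N → Config N → EuclideanSpace ℂ (Fin 2)) : ℝ≥0∞ :=
  ∑ j, ∫⁻ x, ‖D j x‖ₑ ^ 2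

/-- The one-body density `ρ_Ψ(x) = N ∫ |Ψ(x, x₂, …, x_N)|² dx₂ ⋯ dx_N`, with `N = n + 1`. -/
def density {n : ℕ} (Ψ : Config (n + 1) → ℂ) (x : Plane) : ℝ≥0∞ :=
  ((n + 1 : ℕ) : ℝ≥0∞) * ∫⁻ y : Config n, ‖Ψ (Fin.cons x y : Config (n + 1))‖ₑ ^ 2

/-- The ground-state energy (bottom of the spectrum) of `T̂_α + V̂` with `V̂(x) = ∑_j V(x_j)`: the
infimum of its quadratic form `∑_j ∫ |D_j Ψ|² + ∫ V̂ |Ψ|²` over the normalized `Ψ` in the anyon form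
domain for which the potential energy is finite. -/
def groundStateEnergy (α : ℝ) (N : ℕ) (V : Plane → ℝ) : EReal :=
  sInf {e : EReal | ∃ (Ψ : Config N → ℂ) (D : Fin N → Config N → EuclideanSpace ℂ (Fin 2)),
    IsMomentum α Ψ D ∧ eLpNorm Ψ 2 volume = 1 ∧
    (∀ j, Integrable (fun x : Config N => V (x j) * ‖Ψ x‖ ^ 2)) ∧
    e = (kineticEnergy D : EReal) +
      ((∫ x : Config N, (∑ j, V (x j)) * ‖Ψ x‖ ^ 2 : ℝ) : EReal)}

end Anyon

end

/-!
In the relative coordinate of two particles the wave function is even, and the vector potential of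
the other particles contributes only a `π`-periodic gauge phase. Hence the angular momentum of the
pair is bounded below by the distance `fluxGap α` from `α` to `2ℤ`, which gives a Hardy-type
inequality for a close pair. Moving the particles of a square at the cost of their kinetic energy
turns this into a bound for every square holding between two and four particles, and dyadic
subdivision makes the bound linear in the number of particles.

On the other hand, a Ladyzhenskaya-type argument bounds `ℓ² ∫_Q ϱ²` on a square `Q` of side `ℓ` by
the square of the expected particle number in `Q` plus `ℓ²` times that number times the kinetic
energy. Subdividing until the squares hold at most two particles in expectation, the error terms
of the quarters are absorbed by the exclusion energy. This is the density bound on the core, and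
Fatou's lemma extends it to the form domain. The energy bound completes the square:
`∫ V₋ ϱ ≤ κ ∫ ϱ² + (4κ)⁻¹ ∫ V₋²`.
-/

noncomputable section

namespace Anyon

theorem norm_addCircle_coe_le_abs_int_mul_add (p α : ℝ) (n : ℤ) :
    ‖(α : AddCircle p)‖ ≤ |n * p + α| := by
  have hcoe : ((n * p + α : ℝ) : AddCircle p) = α := by
    rw [AddCircle.coe_add, ← zsmul_eq_mul, AddCircle.coe_zsmul, AddCircle.coe_period, smul_zero,
      zero_add]
  rw [← hcoe, ← Real.norm_eq_abs]
  exact QuotientAddGroup.norm_mk_le_norm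

theorem fourierCoeffOn_add {a b : ℝ} (hab : a < b) {f g : ℝ → ℂ}
    (hf : IntervalIntegrable f volume a b) (hg : IntervalIntegrable g volume a b) (n : ℤ) :
    fourierCoeffOn hab (fun x => f x + g x) n =
      fourierCoeffOn hab f n + fourierCoeffOn hab g n := by
  have hcont : Continuous fun x : ℝ => fourier (-n) (x : AddCircle (b - a)) :=
    (map_continuous (fourier (-n))).comp (AddCircle.continuous_mk' _)
  simp only [fourierCoeffOn_eq_integral, smul_eq_mul, mul_add]
  rw [intervalIntegral.integral_add (hf.continuousOn_mul hcont.continuousOn)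
    (hg.continuousOn_mul hcont.continuousOn), smul_add]

theorem fourierCoeffOn_deriv_of_eq_endpoints {a b : ℝ} (hab : a < b) {g g' : ℝ → ℂ}
    (hg : ∀ x, HasDerivAt g (g' x) x) (hg' : IntervalIntegrable g' volume a b) (hper : g b = g a)
    (n : ℤ) :
    fourierCoeffOn hab g' n = 2 * Real.pi / (b - a) * n * Complex.I * fourierCoeffOn hab g n := by
  rcases eq_or_ne n 0 with rfl | hn
  · simp [fourierCoeffOn_eq_integral, intervalIntegral.integral_eq_sub_of_hasDerivAt
      (fun x _ => hg x) hg', hper]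
  · have hn' : (n : ℂ) ≠ 0 := by exact_mod_cast hn
    have hba : (b : ℂ) - a ≠ 0 := by exact_mod_cast (sub_pos.2 hab).ne'
    rw [fourierCoeffOn_of_hasDerivAt hab hn (fun x _ => hg x) hg', hper]
    field_simp
    ring

/-- The distance of `α` to `2ℤ`, the spectrum of `-i d/dθ` on functions with `u(θ + π) = u(θ)`: the
least angular momentum in a state of two bosons with statistics parameter `α`. -/
def fluxGap (α : ℝ) : ℝ := ‖(α : AddCircle (2 : ℝ))‖

theorem fluxGap_nonneg (α : ℝ) : 0 ≤ fluxGap α := norm_nonneg _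

theorem fluxGap_le_one (α : ℝ) : fluxGap α ≤ 1 := by
  simpa [fluxGap] using
    AddCircle.norm_le_half_period (2 : ℝ) (x := (α : AddCircle (2 : ℝ))) two_ne_zero

theorem fluxGap_of_mem_Icc {α : ℝ} (hα : α ∈ Set.Icc 0 1) : fluxGap α = α := by
  have habs := abs_of_nonneg hα.1
  exact ((AddCircle.norm_coe_eq_abs_iff (2 : ℝ) two_ne_zero).2 (by simpa [habs] using hα.2)).trans
    habs

theorem norm_sq_mul_integral_le_integral_momentum (α : ℝ) {a b : ℝ} (hab : a < b) {g g' : ℝ → ℂ}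
    (hg : ∀ x, HasDerivAt g (g' x) x) (hg' : Continuous g') (hper : g b = g a) :
    ‖(α : AddCircle (2 * Real.pi / (b - a)))‖ ^ 2 * ∫ x in a..b, ‖g x‖ ^ 2 ≤
      ∫ x in a..b, ‖-Complex.I * g' x + α * g x‖ ^ 2 := by
  have hgc : Continuous g := continuous_iff_continuousAt.2 fun x => (hg x).continuousAt
  have memLp_two : ∀ {f : ℝ → ℂ}, Continuous f → MemLp f 2 (volume.restrict (Set.Ioc a b)) :=
    fun {f} hf => (memLp_two_iff_integrable_sq_norm hf.aestronglyMeasurable).2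
      ((hf.norm.pow 2).intervalIntegrable a b).1
  have coeff : ∀ n, fourierCoeffOn hab (fun x => -Complex.I * g' x + α * g x) n =
      ((n * (2 * Real.pi / (b - a)) + α : ℝ) : ℂ) * fourierCoeffOn hab g n := fun n => by
    rw [fourierCoeffOn_add hab ((hg'.const_mul _).intervalIntegrable a b)
      ((hgc.const_mul _).intervalIntegrable a b), fourierCoeffOn.const_mul,
      fourierCoeffOn.const_mul, fourierCoeffOn_deriv_of_eq_endpoints hab hg
      (hg'.intervalIntegrable a b) hper]
    push_cast
    linear_combination (-2 * Real.pi / (b - a) * n * fourierCoeffOn hab g n) * Complex.I_sq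
  have parseval := hasSum_le (fun n => ?_)
    ((hasSum_sq_fourierCoeffOn hab (memLp_two hgc)).mul_left
      (‖(α : AddCircle (2 * Real.pi / (b - a)))‖ ^ 2))
    (hasSum_sq_fourierCoeffOn hab
      (memLp_two (by fun_prop : Continuous fun x => -Complex.I * g' x + α * g x)))
  · rw [smul_eq_mul, smul_eq_mul, mul_left_comm] at parseval
    exact le_of_mul_le_mul_left parseval (inv_pos.2 (sub_pos.2 hab))
  · rw [coeff, norm_mul, mul_pow, Complex.norm_real, Real.norm_eq_abs]
    gcongr
    exact norm_addCircle_coe_le_abs_int_mul_add _ _ _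

theorem norm_sq_mul_integral_le_integral_momentum_gauge (α : ℝ) {a b : ℝ} (hab : a < b)
    {f f' : ℝ → ℂ} {φ φ' : ℝ → ℝ} (hf : ∀ x, HasDerivAt f (f' x) x) (hf' : Continuous f')
    (hφ : ∀ x, HasDerivAt φ (φ' x) x) (hφ' : Continuous φ') (hper : f b = f a)
    (hperφ : φ b = φ a) :
    ‖(α : AddCircle (2 * Real.pi / (b - a)))‖ ^ 2 * ∫ x in a..b, ‖f x‖ ^ 2 ≤
      ∫ x in a..b, ‖-Complex.I * f' x + ((α + φ' x : ℝ) : ℂ) * f x‖ ^ 2 := by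
  have hfc : Continuous f := continuous_iff_continuousAt.2 fun x => (hf x).continuousAt
  have hφc : Continuous φ := continuous_iff_continuousAt.2 fun x => (hφ x).continuousAt
  set e : ℝ → ℂ := fun x => Complex.exp (φ x * Complex.I) with he
  have hnorm : ∀ x, ‖e x‖ = 1 := fun x => Complex.norm_exp_ofReal_mul_I (φ x)
  have hg : ∀ x, HasDerivAt (fun x => e x * f x)
      (e x * (f' x + Complex.I * φ' x * f x)) x := fun x =>
    ((((hφ x).ofReal_comp.mul_const Complex.I).cexp).mul (hf x)).congr_deriv (by ring)
  have covariance : ∀ x, -Complex.I * (e x * (f' x + Complex.I * φ' x * f x)) +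
      α * (e x * f x) = e x * (-Complex.I * f' x + ((α + φ' x : ℝ) : ℂ) * f x) := fun x => by
    push_cast
    linear_combination (-e x * φ' x * f x) * Complex.I_sq
  have gauged := norm_sq_mul_integral_le_integral_momentum α hab hg (by fun_prop)
    (by simp only [he, hper, hperφ])
  simpa only [covariance, norm_mul, hnorm, one_mul] using gauged

theorem ofReal_intervalIntegral_norm_sq {E : Type*} [NormedAddCommGroup E] {f : ℝ → E}
    (hf : Continuous f) {a b : ℝ} (hab : a ≤ b) :
    ENNReal.ofReal (∫ t in a..b, ‖f t‖ ^ 2) = ∫⁻ t in Set.Ioc a b, ‖f t‖ₑ ^ 2 := by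
  rw [intervalIntegral.integral_of_le hab, ofReal_integral_eq_lintegral_ofReal]
  · simp only [ENNReal.ofReal_pow (norm_nonneg _), ofReal_norm]
  · exact ((hf.norm.pow 2).intervalIntegrable a b).1
  · exact Eventually.of_forall fun t => by positivity

theorem fluxGap_sq_mul_lintegral_le (α a : ℝ) {f f' : ℝ → ℂ} {φ φ' : ℝ → ℝ}
    (hf : ∀ θ, HasDerivAt f (f' θ) θ) (hf' : Continuous f') (hφ : ∀ θ, HasDerivAt φ (φ' θ) θ)
    (hφ' : Continuous φ') (hper : f (a + Real.pi) = f a) (hperφ : φ (a + Real.pi) = φ a) :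
    ENNReal.ofReal (fluxGap α) ^ 2 * ∫⁻ θ in Set.Ioc a (a + Real.pi), ‖f θ‖ₑ ^ 2 ≤
      ∫⁻ θ in Set.Ioc a (a + Real.pi),
        ‖-Complex.I * f' θ + ((α + φ' θ : ℝ) : ℂ) * f θ‖ₑ ^ 2 := by
  have hab : a < a + Real.pi := lt_add_of_pos_right a Real.pi_pos
  have hfc : Continuous f := continuous_iff_continuousAt.2 fun θ => (hf θ).continuousAt
  have real := norm_sq_mul_integral_le_integral_momentum_gauge α hab hf hf' hφ hφ' hper hperφ
  rw [add_sub_cancel_left, mul_div_cancel_right₀ _ Real.pi_ne_zero] at real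
  rw [← ENNReal.ofReal_pow (fluxGap_nonneg α), ← ofReal_intervalIntegral_norm_sq hfc hab.le,
    ← ofReal_intervalIntegral_norm_sq (by fun_prop) hab.le, ← ENNReal.ofReal_mul (by positivity)]
  exact ENNReal.ofReal_le_ofReal real

theorem two_mul_mul_le_young {t : ℝ≥0∞} (ht : t ≠ 0) (ht' : t ≠ ⊤) (p q : ℝ≥0∞) :
    2 * (p * q) ≤ t⁻¹ * p ^ 2 + t * q ^ 2 := by
  rcases eq_or_ne p ⊤ with rfl | hp
  · simp [ENNReal.mul_top, ht']
  rcases eq_or_ne q ⊤ with rfl | hq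
  · simp [ENNReal.mul_top, ht]
  lift t to NNReal using ht'
  lift p to NNReal using hp
  lift q to NNReal using hq
  have ht₀ : t ≠ 0 := by exact_mod_cast ht
  rw [← ENNReal.coe_inv ht₀]
  norm_cast
  rw [← NNReal.coe_le_coe]
  push_cast
  have ht₁ : (t : ℝ) ≠ 0 := by exact_mod_cast ht₀
  have complete_square : (t : ℝ)⁻¹ * p ^ 2 + t * q ^ 2 - 2 * (p * q) =
      (t : ℝ)⁻¹ * (p - t * q) ^ 2 := by
    field_simp; ring
  exact sub_nonneg.1 (complete_square ▸ by positivity)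

theorem abs_inner_le_norm_mul_norm_momentum (u u' : ℂ) (a : ℝ) :
    |inner ℝ u u'| ≤ ‖u‖ * ‖-Complex.I * u' + a * u‖ := by
  have hinner : inner ℝ u u' = inner ℝ u (Complex.I * (-Complex.I * u' + a * u)) := by
    simp [Complex.inner]; ring
  rw [hinner]
  exact (abs_real_inner_le_norm _ _).trans_eq (by rw [norm_mul, Complex.norm_I, one_mul])

theorem enorm_sq_le_add_lintegral_momentum {u u' : ℝ → ℂ} (hu : ∀ t, HasDerivAt u (u' t) t)
    (hu' : Continuous u') (a : ℝ → ℝ) (s t : ℝ) :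
    ‖u t‖ₑ ^ 2 ≤ ‖u s‖ₑ ^ 2 +
      ∫⁻ τ in Set.uIoc s t, 2 * (‖u τ‖ₑ * ‖-Complex.I * u' τ + a τ * u τ‖ₑ) := by
  have huc : Continuous u := continuous_iff_continuousAt.2 fun t => (hu t).continuousAt
  set v' : ℝ → ℝ := fun τ => 2 * inner ℝ (u τ) (u' τ) with hv'
  have hv'c : Continuous v' := by fun_prop
  have ftc : ∫ τ in s..t, v' τ = ‖u t‖ ^ 2 - ‖u s‖ ^ 2 :=
    intervalIntegral.integral_eq_sub_of_hasDerivAt (fun τ _ => (hu τ).norm_sq)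
      (hv'c.intervalIntegrable s t)
  have real : ‖u t‖ ^ 2 ≤ ‖u s‖ ^ 2 + ∫ τ in Set.uIoc s t, ‖v' τ‖ := by
    rw [← sub_le_iff_le_add', ← ftc]
    exact (Real.le_norm_self _).trans intervalIntegral.norm_integral_le_integral_norm_uIoc
  have pointwise : ∀ τ, ‖v' τ‖ₑ ≤ 2 * (‖u τ‖ₑ * ‖-Complex.I * u' τ + a τ * u τ‖ₑ) := fun τ => by
    simp only [hv', ← ofReal_norm, ← ENNReal.ofReal_mul (norm_nonneg _),
      ← ENNReal.ofReal_ofNat 2, ← ENNReal.ofReal_mul zero_le_two]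
    rw [norm_mul, Real.norm_two, Real.norm_eq_abs]
    gcongr
    exact abs_inner_le_norm_mul_norm_momentum _ _ _
  calc ‖u t‖ₑ ^ 2 = ENNReal.ofReal (‖u t‖ ^ 2) := by
        rw [ENNReal.ofReal_pow (norm_nonneg _), ofReal_norm]
    _ ≤ ENNReal.ofReal (‖u s‖ ^ 2 + ∫ τ in Set.uIoc s t, ‖v' τ‖) := ENNReal.ofReal_le_ofReal real
    _ = ‖u s‖ₑ ^ 2 + ∫⁻ τ in Set.uIoc s t, ‖v' τ‖ₑ := by
        rw [ENNReal.ofReal_add (by positivity) (by positivity), ENNReal.ofReal_pow (norm_nonneg _),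
          ofReal_norm, ofReal_integral_norm_eq_lintegral_enorm hv'c.integrableOn_uIoc]
    _ ≤ _ := by gcongr with τ; exact pointwise τ

theorem lintegral_plane (f : Plane → ℝ≥0∞) :
    ∫⁻ z : Plane, f z = ∫⁻ p : ℝ × ℝ, f !₂[p.1, p.2] := by
  have hpres := (EuclideanSpace.volume_preserving_symm_measurableEquiv_toLp (Fin 2)).symm.comp
    (volume_preserving_finTwoArrow ℝ).symm
  rw [← hpres.map_eq]
  exact lintegral_map_equiv f ((MeasurableEquiv.finTwoArrow (α := ℝ)).symm.trans
    (MeasurableEquiv.toLp 2 (Fin 2 → ℝ)))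

/-- The radial unit vector `e_r` at polar angle `θ`. -/
def unitVec (θ : ℝ) : Plane := !₂[Real.cos θ, Real.sin θ]

/-- The tangential unit vector `e_θ` at polar angle `θ`. -/
def unitPerp (θ : ℝ) : Plane := !₂[-Real.sin θ, Real.cos θ]

theorem norm_smul_unitVec {t : ℝ} (ht : 0 ≤ t) (θ : ℝ) : ‖t • unitVec θ‖ = t := by
  simp [unitVec, norm_smul, EuclideanSpace.norm_eq, abs_of_nonneg ht]

theorem unitVec_add_pi (θ : ℝ) : unitVec (θ + Real.pi) = -unitVec θ := by
  ext a; fin_cases a <;> simp [unitVec]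

theorem hasDerivAt_unitVec (θ : ℝ) : HasDerivAt unitVec (unitPerp θ) θ := by
  have hcoord : HasDerivAt (fun θ => ![Real.cos θ, Real.sin θ]) ![-Real.sin θ, Real.cos θ] θ :=
    hasDerivAt_pi.2 (by simp [Fin.forall_fin_two, Real.hasDerivAt_cos, Real.hasDerivAt_sin])
  exact (PiLp.hasFDerivAt_toLp 2 _).comp_hasDerivAt θ hcoord

@[fun_prop]
theorem continuous_unitVec : Continuous unitVec :=
  continuous_iff_continuousAt.2 fun θ => (hasDerivAt_unitVec θ).continuousAt

@[fun_prop]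
theorem continuous_unitPerp : Continuous unitPerp := by
  unfold unitPerp
  fun_prop

theorem lintegral_polar {h : Plane → ℝ≥0∞} (hh : Measurable h) :
    ∫⁻ z, h z = ∫⁻ s in Set.Ioi 0, ENNReal.ofReal s *
      ∫⁻ θ in Set.Ioc (-Real.pi) Real.pi, h (s • unitVec θ) := by
  have hpolar : ∀ p : ℝ × ℝ, (!₂[(polarCoord.symm p).1, (polarCoord.symm p).2] : Plane) =
      p.1 • unitVec p.2 := fun p => by
    ext a; fin_cases a <;> simp [unitVec]
  rw [lintegral_plane, ← lintegral_comp_polarCoord_symm, polarCoord_target, Measure.volume_eq_prod,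
    ← Measure.prod_restrict]
  simp only [hpolar, smul_eq_mul]
  rw [lintegral_prod _ (by fun_prop)]
  refine lintegral_congr fun s => ?_
  dsimp only
  rw [lintegral_const_mul _ (by fun_prop), restrict_Ioo_eq_restrict_Ioc]

theorem setLIntegral_ball_polar {h : Plane → ℝ≥0∞} (hh : Measurable h) (δ : ℝ) :
    ∫⁻ z in Metric.ball 0 δ, h z = ∫⁻ s in Set.Ioo 0 δ, ENNReal.ofReal s *
      ∫⁻ θ in Set.Ioc (-Real.pi) Real.pi, h (s • unitVec θ) := by
  rw [← lintegral_indicator Metric.isOpen_ball.measurableSet,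
    lintegral_polar (hh.indicator Metric.isOpen_ball.measurableSet), ← Set.Ioi_inter_Iio,
    Set.inter_comm, ← setLIntegral_indicator measurableSet_Iio]
  refine setLIntegral_congr_fun measurableSet_Ioi fun s hs => ?_
  have hmem : ∀ θ, s • unitVec θ ∈ Metric.ball 0 δ ↔ s ∈ Set.Iio δ := fun θ => by
    rw [mem_ball_zero_iff, norm_smul_unitVec (le_of_lt hs), Set.mem_Iio]
  by_cases hsδ : s ∈ Set.Iio δ <;> simp [Set.indicator, hmem, hsδ]

theorem lintegral_ofReal_Ioo {δ : ℝ} (hδ : 0 ≤ δ) :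
    ∫⁻ s in Set.Ioo 0 δ, ENNReal.ofReal s = ENNReal.ofReal (δ ^ 2 / 2) := by
  rw [restrict_Ioo_eq_restrict_Ioc, ← ofReal_integral_eq_lintegral_ofReal,
    ← intervalIntegral.integral_of_le hδ, integral_id]
  · simp
  · exact (continuous_id.intervalIntegrable 0 δ).1
  · filter_upwards [ae_restrict_mem measurableSet_Ioc] with s hs using hs.1.le

theorem lintegral_Ioc_neg_pi_pi (h : ℝ → ℝ≥0∞) :
    ∫⁻ θ in Set.Ioc (-Real.pi) Real.pi, h θ =
      (∫⁻ θ in Set.Ioc (-Real.pi) (-Real.pi + Real.pi), h θ) +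
        ∫⁻ θ in Set.Ioc 0 (0 + Real.pi), h θ := by
  rw [neg_add_cancel, zero_add, ← lintegral_union measurableSet_Ioc
    (Set.Ioc_disjoint_Ioc_of_le le_rfl),
    Set.Ioc_union_Ioc_eq_Ioc (neg_nonpos.2 Real.pi_pos.le) Real.pi_pos.le]

/-- The component `v · G` of a complex vector `G` along a real vector `v`. -/
def component (v : Plane) (G : EuclideanSpace ℂ (Fin 2)) : ℂ := ∑ a, (v a : ℂ) * G a

/-- The magnetic derivative `-i ∇F + A F` of a function `F` on the plane. -/
def covariantDeriv (A : Plane → Plane) (F : Plane → ℂ) (r : Plane) : EuclideanSpace ℂ (Fin 2) :=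
  WithLp.toLp 2 fun a =>
    -Complex.I * fderiv ℝ F r (EuclideanSpace.single a 1) + (A r a : ℂ) * F r

theorem component_covariantDeriv (v : Plane) (A : Plane → Plane) (F : Plane → ℂ) (r : Plane) :
    component v (covariantDeriv A F r) =
      -Complex.I * fderiv ℝ F r v + ((inner ℝ v (A r) : ℝ) : ℂ) * F r := by
  have hv : v = v 0 • EuclideanSpace.single 0 (1 : ℝ) + v 1 • EuclideanSpace.single 1 (1 : ℝ) := by
    ext b; fin_cases b <;> simp
  have hderiv : fderiv ℝ F r v = v 0 * fderiv ℝ F r (EuclideanSpace.single 0 1) +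
      v 1 * fderiv ℝ F r (EuclideanSpace.single 1 1) := by
    conv_lhs => rw [hv]
    simp only [map_add, map_smul, Complex.real_smul]
  rw [hderiv]
  simp [component, covariantDeriv, Fin.sum_univ_two, PiLp.inner_apply]
  ring

theorem enorm_sq_eq_component_unitVec_add_unitPerp (G : EuclideanSpace ℂ (Fin 2)) (θ : ℝ) :
    ‖G‖ₑ ^ 2 = ‖component (unitVec θ) G‖ₑ ^ 2 + ‖component (unitPerp θ) G‖ₑ ^ 2 := by
  simp only [← ofReal_norm, ← ENNReal.ofReal_pow (norm_nonneg _)]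
  rw [← ENNReal.ofReal_add (by positivity) (by positivity), EuclideanSpace.norm_sq_eq]
  congr 1
  have hθ := Real.sin_sq_add_cos_sq θ
  simp only [component, unitVec, unitPerp, Fin.sum_univ_two, Complex.sq_norm, Complex.normSq_apply]
  simp [-Complex.ofReal_cos, -Complex.ofReal_sin]
  linear_combination (-((G 0).re ^ 2 + (G 0).im ^ 2 + (G 1).re ^ 2 + (G 1).im ^ 2)) * hθ

@[fun_prop]
theorem measurable_component : Measurable fun p : Plane × EuclideanSpace ℂ (Fin 2) =>
    component p.1 p.2 := by
  unfold component
  fun_prop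

@[fun_prop]
theorem measurable_covariantDeriv {A : Plane → Plane} {F : Plane → ℂ} (hA : Measurable A)
    (hF : ContDiff ℝ 1 F) : Measurable (covariantDeriv A F) := by
  have := hF.continuous_fderiv one_ne_zero
  have := hF.continuous
  unfold covariantDeriv
  fun_prop

/-- On the circle of radius `t` the potential `A` is that of a flux `2πα` at the origin, up to the
gauge transformation by an even function. -/
def IsFluxOn (A : Plane → Plane) (α t : ℝ) : Prop :=
  ∃ φ φ' : ℝ → ℝ, (∀ θ, HasDerivAt φ (φ' θ) θ) ∧ Continuous φ' ∧
    (∀ θ, φ (θ + Real.pi) = φ θ) ∧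
    ∀ θ, t * inner ℝ (unitPerp θ) (A (t • unitVec θ)) = α + φ' θ

section Disc

variable {α δ : ℝ} {F : Plane → ℂ} {A : Plane → Plane}

theorem smul_component_unitPerp_covariantDeriv {φ' : ℝ → ℝ} {t θ : ℝ}
    (hflux : t * inner ℝ (unitPerp θ) (A (t • unitVec θ)) = α + φ' θ) :
    (t : ℂ) * component (unitPerp θ) (covariantDeriv A F (t • unitVec θ)) =
      -Complex.I * fderiv ℝ F (t • unitVec θ) (t • unitPerp θ) +
        ((α + φ' θ : ℝ) : ℂ) * F (t • unitVec θ) := by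
  rw [component_covariantDeriv, ← hflux, map_smul, Complex.real_smul]
  push_cast
  ring

theorem fluxGap_sq_mul_lintegral_circle_le (hF : ContDiff ℝ 1 F) (heven : ∀ r, F (-r) = F r)
    {t : ℝ} (ht : 0 ≤ t) (hA : IsFluxOn A α t) :
    ENNReal.ofReal (fluxGap α) ^ 2 *
        ∫⁻ θ in Set.Ioc (-Real.pi) Real.pi, ‖F (t • unitVec θ)‖ₑ ^ 2 ≤
      ENNReal.ofReal t ^ 2 * ∫⁻ θ in Set.Ioc (-Real.pi) Real.pi,
        ‖component (unitPerp θ) (covariantDeriv A F (t • unitVec θ))‖ₑ ^ 2 := by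
  obtain ⟨φ, φ', hφ, hφ', hper, hflux⟩ := hA
  have hf : ∀ θ, HasDerivAt (fun θ => F (t • unitVec θ))
      (fderiv ℝ F (t • unitVec θ) (t • unitPerp θ)) θ := fun θ =>
    (hF.differentiable one_ne_zero _).hasFDerivAt.comp_hasDerivAt θ
      ((hasDerivAt_unitVec θ).const_smul t)
  have hf' : Continuous fun θ => fderiv ℝ F (t • unitVec θ) (t • unitPerp θ) := by
    have := hF.continuous_fderiv one_ne_zero
    fun_prop
  have hfper : ∀ θ, F (t • unitVec (θ + Real.pi)) = F (t • unitVec θ) := fun θ => by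
    rw [unitVec_add_pi, smul_neg, heven]
  have half_circle : ∀ a : ℝ, ENNReal.ofReal (fluxGap α) ^ 2 *
      ∫⁻ θ in Set.Ioc a (a + Real.pi), ‖F (t • unitVec θ)‖ₑ ^ 2 ≤
      ENNReal.ofReal t ^ 2 * ∫⁻ θ in Set.Ioc a (a + Real.pi),
        ‖component (unitPerp θ) (covariantDeriv A F (t • unitVec θ))‖ₑ ^ 2 := fun a => by
    refine (fluxGap_sq_mul_lintegral_le α a hf hf' hφ hφ' (hfper a) (hper a)).trans_eq ?_
    rw [← lintegral_const_mul' _ _ (by finiteness)]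
    refine lintegral_congr fun θ => ?_
    rw [← smul_component_unitPerp_covariantDeriv (hflux θ), enorm_mul, mul_pow, ← ofReal_norm,
      Complex.norm_real, Real.norm_of_nonneg ht]
  rw [lintegral_Ioc_neg_pi_pi, lintegral_Ioc_neg_pi_pi, mul_add, mul_add]
  exact add_le_add (half_circle _) (half_circle _)

theorem mul_enorm_sq_le_lintegral_ray (hF : ContDiff ℝ 1 F) (hF0 : F 0 = 0) {c : ℝ≥0∞}
    (hc : c ≠ ⊤) {s : ℝ} (hs : 0 ≤ s) (θ : ℝ) :
    c * ‖F (s • unitVec θ)‖ₑ ^ 2 ≤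
      ∫⁻ t in Set.Ioc 0 s, ((ENNReal.ofReal t)⁻¹ * (c ^ 2 * ‖F (t • unitVec θ)‖ₑ ^ 2) +
        ENNReal.ofReal t * ‖component (unitVec θ) (covariantDeriv A F (t • unitVec θ))‖ₑ ^ 2) := by
  have hu : ∀ t : ℝ, HasDerivAt (fun t : ℝ => F (t • unitVec θ))
      (fderiv ℝ F (t • unitVec θ) (unitVec θ)) t := fun t =>
    ((hF.differentiable one_ne_zero (t • unitVec θ)).hasFDerivAt.comp_hasDerivAt t
      ((hasDerivAt_id t).smul_const (unitVec θ))).congr_deriv (by simp)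
  have hu' : Continuous fun t : ℝ => fderiv ℝ F (t • unitVec θ) (unitVec θ) := by
    have := hF.continuous_fderiv one_ne_zero
    fun_prop
  have ftc := enorm_sq_le_add_lintegral_momentum hu hu'
    (fun t => inner ℝ (unitVec θ) (A (t • unitVec θ))) 0 s
  simp only [← component_covariantDeriv, zero_smul, hF0, enorm_zero, ne_eq, OfNat.ofNat_ne_zero,
    not_false_eq_true, zero_pow, zero_add, Set.uIoc_of_le hs] at ftc
  refine (mul_le_mul_right ftc c).trans ?_
  rw [← lintegral_const_mul' _ _ hc]
  refine setLIntegral_mono' measurableSet_Ioc fun t ht => ?_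
  rw [mul_left_comm, ← mul_assoc c, ← mul_pow]
  exact two_mul_mul_le_young (by simpa using ht.1) ENNReal.ofReal_ne_top _ _

theorem lintegral_ring_le (hF : ContDiff ℝ 1 F) (heven : ∀ r, F (-r) = F r) (hA : Measurable A)
    {t : ℝ} (ht : 0 < t) (hflux : IsFluxOn A α t) :
    ∫⁻ θ in Set.Ioc (-Real.pi) Real.pi,
        ((ENNReal.ofReal t)⁻¹ * (ENNReal.ofReal (fluxGap α) ^ 2 * ‖F (t • unitVec θ)‖ₑ ^ 2) +
          ENNReal.ofReal t *
            ‖component (unitVec θ) (covariantDeriv A F (t • unitVec θ))‖ₑ ^ 2) ≤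
      ENNReal.ofReal t * ∫⁻ θ in Set.Ioc (-Real.pi) Real.pi,
        ‖covariantDeriv A F (t • unitVec θ)‖ₑ ^ 2 := by
  have ht₀ : ENNReal.ofReal t ≠ 0 := by simpa using ht
  have := hF.continuous.measurable
  have := measurable_covariantDeriv hA hF
  have pythagoras : ∀ θ, ‖covariantDeriv A F (t • unitVec θ)‖ₑ ^ 2 = _ := fun θ =>
    enorm_sq_eq_component_unitVec_add_unitPerp _ θ
  simp only [pythagoras]
  rw [lintegral_add_left (by fun_prop), lintegral_const_mul' _ _ (by finiteness),
    lintegral_const_mul' _ _ (by finiteness), lintegral_const_mul' _ _ ENNReal.ofReal_ne_top,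
    lintegral_add_left (by fun_prop), mul_add, add_comm]
  refine add_le_add le_rfl
    ((mul_le_mul_right (fluxGap_sq_mul_lintegral_circle_le hF heven ht.le hflux) _).trans_eq ?_)
  rw [sq, mul_assoc, ← mul_assoc, ENNReal.inv_mul_cancel ht₀ ENNReal.ofReal_ne_top, one_mul]

theorem fluxGap_mul_lintegral_circle_le (hF : ContDiff ℝ 1 F) (hF0 : F 0 = 0)
    (heven : ∀ r, F (-r) = F r) (hA : Measurable A)
    (hflux : ∀ t, 0 < t → t < δ → IsFluxOn A α t) {s : ℝ} (hs : 0 < s) (hsδ : s < δ) :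
    ENNReal.ofReal (fluxGap α) *
        ∫⁻ θ in Set.Ioc (-Real.pi) Real.pi, ‖F (s • unitVec θ)‖ₑ ^ 2 ≤
      ∫⁻ r in Metric.ball 0 δ, ‖covariantDeriv A F r‖ₑ ^ 2 := by
  have hFc := hF.continuous
  have := measurable_covariantDeriv hA hF
  calc _ ≤ ∫⁻ θ in Set.Ioc (-Real.pi) Real.pi, ∫⁻ t in Set.Ioc 0 s,
          ((ENNReal.ofReal t)⁻¹ * (ENNReal.ofReal (fluxGap α) ^ 2 * ‖F (t • unitVec θ)‖ₑ ^ 2) +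
            ENNReal.ofReal t *
              ‖component (unitVec θ) (covariantDeriv A F (t • unitVec θ))‖ₑ ^ 2) := by
        rw [← lintegral_const_mul' _ _ ENNReal.ofReal_ne_top]
        gcongr with θ
        exact mul_enorm_sq_le_lintegral_ray hF hF0 ENNReal.ofReal_ne_top hs.le θ
    _ = ∫⁻ t in Set.Ioc 0 s, ∫⁻ θ in Set.Ioc (-Real.pi) Real.pi,
          ((ENNReal.ofReal t)⁻¹ * (ENNReal.ofReal (fluxGap α) ^ 2 * ‖F (t • unitVec θ)‖ₑ ^ 2) +
            ENNReal.ofReal t *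
              ‖component (unitVec θ) (covariantDeriv A F (t • unitVec θ))‖ₑ ^ 2) :=
        lintegral_lintegral_swap (by fun_prop)
    _ ≤ ∫⁻ t in Set.Ioc 0 s, ENNReal.ofReal t * ∫⁻ θ in Set.Ioc (-Real.pi) Real.pi,
          ‖covariantDeriv A F (t • unitVec θ)‖ₑ ^ 2 :=
        setLIntegral_mono' measurableSet_Ioc fun t ht =>
          lintegral_ring_le hF heven hA ht.1 (hflux t ht.1 (ht.2.trans_lt hsδ))
    _ ≤ _ := by
        rw [setLIntegral_ball_polar (by fun_prop)]
        exact lintegral_mono_set fun t ht => ⟨ht.1, ht.2.trans_lt hsδ⟩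

theorem fluxGap_mul_lintegral_ball_le (hδ : 0 ≤ δ) (hF : ContDiff ℝ 1 F) (hF0 : F 0 = 0)
    (heven : ∀ r, F (-r) = F r) (hA : Measurable A)
    (hflux : ∀ t, 0 < t → t < δ → IsFluxOn A α t) :
    ENNReal.ofReal (fluxGap α) * ∫⁻ r in Metric.ball 0 δ, ‖F r‖ₑ ^ 2 ≤
      ENNReal.ofReal (δ ^ 2 / 2) * ∫⁻ r in Metric.ball 0 δ, ‖covariantDeriv A F r‖ₑ ^ 2 := by
  rw [setLIntegral_ball_polar (hF.continuous.measurable.enorm.pow_const 2),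
    ← lintegral_const_mul' _ _ ENNReal.ofReal_ne_top, ← lintegral_ofReal_Ioo hδ,
    ← lintegral_mul_const _ (by fun_prop)]
  refine setLIntegral_mono' measurableSet_Ioo fun s hs => ?_
  rw [mul_left_comm]
  gcongr
  exact fluxGap_mul_lintegral_circle_le hF hF0 heven hA hflux hs.1 hs.2

end Disc

/-- The identification of the plane with `ℂ`, under which rotations become multiplications and
`perpInv u` becomes the conjugate of `1 / (i u)`. -/
def toComplex : Plane ≃ₗᵢ[ℝ] ℂ := Complex.orthonormalBasisOneI.repr.symm

theorem toComplex_apply (z : Plane) : toComplex z = z 0 + z 1 * Complex.I :=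
  Complex.orthonormalBasisOneI_repr_symm_apply z

theorem toComplex_smul_unitVec (t θ : ℝ) :
    toComplex (t • unitVec θ) = t * Complex.exp (θ * Complex.I) := by
  simp [toComplex_apply, unitVec, Complex.exp_mul_I]
  ring

theorem toComplex_smul_unitPerp (t θ : ℝ) :
    toComplex (t • unitPerp θ) = Complex.I * toComplex (t • unitVec θ) := by
  simp [toComplex_apply, unitVec, unitPerp]
  linear_combination (-(t : ℂ) * Complex.sin θ) * Complex.I_sq

theorem hasDerivAt_toComplex_smul_unitVec (t θ : ℝ) :
    HasDerivAt (fun θ => toComplex (t • unitVec θ)) (toComplex (t • unitPerp θ)) θ :=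
  toComplex.toContinuousLinearEquiv.hasFDerivAt.comp_hasDerivAt θ
    ((hasDerivAt_unitVec θ).const_smul t)

theorem inner_perpInv (v u : Plane) :
    inner ℝ v (perpInv u) = (toComplex v / toComplex u).im := by
  have hu : ‖u‖ ^ 2 = Complex.normSq (toComplex u) := by
    rw [Complex.normSq_eq_norm_sq, LinearIsometryEquiv.norm_map]
  rw [Complex.div_im, ← hu]
  simp [perpInv, toComplex_apply, PiLp.inner_apply, Fin.sum_univ_two]
  ring

theorem perpInv_neg (u : Plane) : perpInv (-u) = -perpInv u := by
  ext a; fin_cases a <;> simp [perpInv, neg_div]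

@[fun_prop]
theorem measurable_perpInv : Measurable perpInv := by
  unfold perpInv
  fun_prop

theorem continuous_perpInv_comp {X : Type*} [TopologicalSpace X] {f : X → Plane}
    (hf : Continuous f) (hf₀ : ∀ x, f x ≠ 0) : Continuous fun x => perpInv (f x) := by
  have : ∀ x, ‖f x‖ ^ 2 ≠ 0 := fun x => pow_ne_zero 2 (norm_ne_zero_iff.2 (hf₀ x))
  unfold perpInv
  fun_prop (disch := assumption)

theorem inner_smul_unitPerp_perpInv {t : ℝ} (ht : t ≠ 0) (θ : ℝ) :
    inner ℝ (t • unitPerp θ) (perpInv (t • unitVec θ)) = 1 := by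
  have : toComplex (t • unitVec θ) ≠ 0 := by
    rw [toComplex_smul_unitVec]
    simpa using ht
  rw [inner_perpInv, toComplex_smul_unitPerp, mul_div_cancel_right₀ _ this, Complex.I_im]

/-- The phase that a pair at relative position `t e_r(θ)` picks up from a third particle, seen from
which the midpoint of the pair is at `u`. -/
def outerPhase (u : Plane) (t θ : ℝ) : ℝ :=
  (Complex.log (1 - (toComplex (t • unitVec θ) / (2 * toComplex u)) ^ 2)).im

theorem outerPhase_add_pi (u : Plane) (t θ : ℝ) :
    outerPhase u t (θ + Real.pi) = outerPhase u t θ := by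
  simp only [outerPhase, unitVec_add_pi, smul_neg, map_neg, neg_div, neg_sq]

section OuterPhase

variable {t : ℝ} {u : Plane}

theorem norm_half_smul_unitVec_lt (ht : 0 ≤ t) (hu : t / 2 < ‖u‖) (θ : ℝ) :
    ‖(1 / 2 : ℝ) • t • unitVec θ‖ < ‖u‖ := by
  rw [norm_smul, norm_smul_unitVec ht, Real.norm_of_nonneg one_half_pos.le]
  linarith

theorem add_half_smul_unitVec_ne_zero (ht : 0 ≤ t) (hu : t / 2 < ‖u‖) (θ : ℝ) :
    u + (1 / 2 : ℝ) • t • unitVec θ ≠ 0 := fun h =>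
  (norm_half_smul_unitVec_lt ht hu θ).ne' (by rw [eq_neg_of_add_eq_zero_left h, norm_neg])

theorem sub_half_smul_unitVec_ne_zero (ht : 0 ≤ t) (hu : t / 2 < ‖u‖) (θ : ℝ) :
    u - (1 / 2 : ℝ) • t • unitVec θ ≠ 0 := fun h =>
  (norm_half_smul_unitVec_lt ht hu θ).ne' (by rw [sub_eq_zero.1 h])

theorem one_sub_sq_mem_slitPlane {z : ℂ} (hz : ‖z‖ < 1) : 1 - z ^ 2 ∈ Complex.slitPlane := by
  refine Or.inl ?_
  have hz₂ : ‖z ^ 2‖ < 1 := norm_pow z 2 ▸ pow_lt_one₀ (norm_nonneg z) hz two_ne_zero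
  simpa using (Complex.re_le_norm _).trans_lt hz₂

theorem log_deriv_eq_partial_fractions {r w : ℂ} (hw : w ≠ 0) (hadd : w + r / 2 ≠ 0)
    (hsub : w - r / 2 ≠ 0) :
    -(2 * (r / (2 * w)) * (Complex.I * r / (2 * w))) / (1 - (r / (2 * w)) ^ 2) =
      ((1 / 2 : ℝ) : ℂ) * (Complex.I * r / (w + r / 2) - Complex.I * r / (w - r / 2)) := by
  have hprod : 1 - (r / (2 * w)) ^ 2 = (w + r / 2) * (w - r / 2) / w ^ 2 := by
    field_simp; ring
  have hadd' : 2 * w + r ≠ 0 := fun h => hadd (by linear_combination h / 2)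
  have hsub' : 2 * w - r ≠ 0 := fun h => hsub (by linear_combination h / 2)
  rw [hprod]
  push_cast
  field_simp
  ring

theorem hasDerivAt_outerPhase (ht : 0 ≤ t) (hu : t / 2 < ‖u‖) (θ : ℝ) :
    HasDerivAt (outerPhase u t) (inner ℝ (t • unitPerp θ) ((1 / 2 : ℝ) •
      (perpInv (u + (1 / 2 : ℝ) • t • unitVec θ) -
        perpInv (u - (1 / 2 : ℝ) • t • unitVec θ)))) θ := by
  set r := toComplex (t • unitVec θ) with hr
  set w := toComplex u with hw
  have hw₀ : w ≠ 0 := by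
    rw [hw, ne_eq, map_eq_zero_iff _ toComplex.injective, ← norm_eq_zero]
    exact (lt_of_le_of_lt (by positivity) hu).ne'
  have hadd : toComplex (u + (1 / 2 : ℝ) • t • unitVec θ) = w + r / 2 := by
    rw [map_add, map_smul, Complex.real_smul]; push_cast; ring
  have hsub : toComplex (u - (1 / 2 : ℝ) • t • unitVec θ) = w - r / 2 := by
    rw [map_sub, map_smul, Complex.real_smul]; push_cast; ring
  have hadd₀ : w + r / 2 ≠ 0 := hadd ▸
    (map_ne_zero_iff _ toComplex.injective).2 (add_half_smul_unitVec_ne_zero ht hu θ)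
  have hsub₀ : w - r / 2 ≠ 0 := hsub ▸
    (map_ne_zero_iff _ toComplex.injective).2 (sub_half_smul_unitVec_ne_zero ht hu θ)
  have hslit : 1 - (r / (2 * w)) ^ 2 ∈ Complex.slitPlane := by
    refine one_sub_sq_mem_slitPlane ?_
    rw [norm_div, norm_mul, Complex.norm_two, hr, hw, LinearIsometryEquiv.norm_map,
      LinearIsometryEquiv.norm_map, norm_smul_unitVec ht, div_lt_one (by linarith)]
    linarith
  have hlog := ((((hasDerivAt_toComplex_smul_unitVec t θ).div_const (2 * w)).pow 2).const_sub
    1).clog_real hslit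
  refine (Complex.imCLM.hasFDerivAt.comp_hasDerivAt θ hlog).congr_deriv ?_
  rw [inner_smul_right, inner_sub_right, inner_perpInv, inner_perpInv, hadd, hsub,
    toComplex_smul_unitPerp, ← Complex.sub_im, ← Complex.im_ofReal_mul, ← hr,
    ← log_deriv_eq_partial_fractions hw₀ hadd₀ hsub₀]
  simp [-map_smul, ← hr]

end OuterPhase

section Pair

variable {N : ℕ} {j k : Fin N}

/-- The configuration `x` with the particles `j` and `k` moved to `X ± r / 2`. -/
def pairPath (j k : Fin N) (X : Plane) (x : Config N) (r : Plane) : Config N :=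
  fun l => if l = j then X + (1 / 2 : ℝ) • r else if l = k then X - (1 / 2 : ℝ) • r else x l

theorem pairPath_left (j k : Fin N) (X : Plane) (x : Config N) (r : Plane) :
    pairPath j k X x r j = X + (1 / 2 : ℝ) • r := by simp [pairPath]

theorem pairPath_right (hjk : j ≠ k) (X : Plane) (x : Config N) (r : Plane) :
    pairPath j k X x r k = X - (1 / 2 : ℝ) • r := by simp [pairPath, hjk.symm]

theorem pairPath_of_ne {l : Fin N} (hj : l ≠ j) (hk : l ≠ k) (X : Plane) (x : Config N)
    (r : Plane) : pairPath j k X x r l = x l := by simp [pairPath, hj, hk]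

theorem vectorPotential_sub_pairPath (hjk : j ≠ k) (X : Plane) (x : Config N) (r : Plane) :
    vectorPotential j (pairPath j k X x r) - vectorPotential k (pairPath j k X x r) =
      (2 : ℝ) • perpInv r + ∑ l ∈ (Finset.univ.erase j).erase k,
        (perpInv (X - x l + (1 / 2 : ℝ) • r) - perpInv (X - x l - (1 / 2 : ℝ) • r)) := by
  have hk : k ∈ Finset.univ.erase j := by simp [hjk.symm]
  have hj : j ∈ Finset.univ.erase k := by simp [hjk]
  have hdiff : X + (1 / 2 : ℝ) • r - (X - (1 / 2 : ℝ) • r) = r := by module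
  rw [vectorPotential, vectorPotential, ← Finset.add_sum_erase _ _ hk,
    ← Finset.add_sum_erase _ _ hj, Finset.erase_right_comm (a := k), pairPath_left,
    pairPath_right hjk, ← neg_sub (X + _), hdiff, perpInv_neg, add_sub_add_comm,
    ← Finset.sum_sub_distrib, sub_neg_eq_add, two_smul]
  congr 1
  refine Finset.sum_congr rfl fun l hl => ?_
  obtain ⟨hlk, hlj⟩ : l ≠ k ∧ l ≠ j := by simpa using hl
  rw [pairPath_of_ne hlj hlk, add_sub_right_comm, sub_right_comm]

theorem isFluxOn_pairPath (hjk : j ≠ k) (α : ℝ) {X : Plane} {x : Config N} {t : ℝ} (ht : 0 < t)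
    (hx : ∀ l, l ≠ j → l ≠ k → t / 2 < ‖X - x l‖) :
    IsFluxOn (fun r => (α / 2) • (vectorPotential j (pairPath j k X x r) -
      vectorPotential k (pairPath j k X x r))) α t := by
  have hx' : ∀ l ∈ (Finset.univ.erase j).erase k, t / 2 < ‖X - x l‖ := fun l hl => by
    obtain ⟨hlk, hlj⟩ : l ≠ k ∧ l ≠ j := by simpa using hl
    exact hx l hlj hlk
  refine ⟨fun θ => α * ∑ l ∈ (Finset.univ.erase j).erase k, outerPhase (X - x l) t θ, _,
    fun θ => (HasDerivAt.fun_sum fun l hl => hasDerivAt_outerPhase ht.le (hx' l hl) θ).const_mul α,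
    ?_, fun θ => by simp only [outerPhase_add_pi], fun θ => ?_⟩
  · refine continuous_const.mul (continuous_finsetSum _ fun l hl => ?_)
    have := continuous_perpInv_comp (by fun_prop) (add_half_smul_unitVec_ne_zero ht.le (hx' l hl))
    have := continuous_perpInv_comp (by fun_prop) (sub_half_smul_unitVec_ne_zero ht.le (hx' l hl))
    fun_prop
  · rw [← real_inner_smul_left, real_inner_smul_right, vectorPotential_sub_pairPath hjk,
      inner_add_right, real_inner_smul_right, inner_smul_unitPerp_perpInv ht.ne', inner_sum]
    simp only [real_inner_smul_right, ← Finset.mul_sum]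
    ring

end Pair

theorem enorm_half_smul_sub_sq_le {E : Type*} [SeminormedAddCommGroup E] [NormedSpace ℝ E]
    (u v : E) : ‖(1 / 2 : ℝ) • (u - v)‖ₑ ^ 2 ≤ ENNReal.ofReal (1 / 2) * (‖u‖ₑ ^ 2 + ‖v‖ₑ ^ 2) := by
  simp only [← ofReal_norm, ← ENNReal.ofReal_pow (norm_nonneg _)]
  rw [← ENNReal.ofReal_add (by positivity) (by positivity), ← ENNReal.ofReal_mul (by norm_num)]
  apply ENNReal.ofReal_le_ofReal
  calc ‖(1 / 2 : ℝ) • (u - v)‖ ^ 2 ≤ (1 / 2 * (‖u‖ + ‖v‖)) ^ 2 := by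
        rw [norm_smul, Real.norm_of_nonneg one_half_pos.le]
        gcongr
        exact norm_sub_le u v
    _ ≤ 1 / 2 * (‖u‖ ^ 2 + ‖v‖ ^ 2) := by linarith [add_sq_le (a := ‖u‖) (b := ‖v‖)]

section Momentum

variable {N : ℕ} {η : Config N → ℂ}

@[fun_prop]
theorem measurable_vectorPotential (j : Fin N) : Measurable (vectorPotential j) := by
  unfold vectorPotential
  fun_prop

theorem continuous_partialDeriv (hη : ContDiff ℝ 1 η) (j : Fin N) (a : Fin 2) :
    Continuous (partialDeriv j a η) := by
  have := hη.continuous_fderiv one_ne_zero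
  unfold partialDeriv
  fun_prop

theorem measurable_momentum (hη : ContDiff ℝ 1 η) (α : ℝ) (j : Fin N) :
    Measurable (momentum α j η) := by
  have : ∀ a, Measurable (partialDeriv j a η) := fun a =>
    (continuous_partialDeriv hη j a).measurable
  have := hη.continuous.measurable
  unfold momentum
  fun_prop

theorem IsCore.contDiff_one (hη : IsCore η) : ContDiff ℝ 1 η := hη.smooth.of_le (by simp)

theorem IsCore.eq_zero_of_eq (hη : IsCore η) {x : Config N} {j k : Fin N} (hjk : j ≠ k)
    (hx : x j = x k) : η x = 0 :=
  image_eq_zero_of_notMem_tsupport fun h => hη.support h j k hjk hx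

end Momentum

section PairIntegral

variable {N : ℕ} {j k : Fin N}

/-- The linear map to the configuration with midpoint `x j` and relative coordinate `x k`. -/
def pairLinear (j k : Fin N) : Config N →ₗ[ℝ] Config N :=
  LinearMap.pi fun l =>
    if l = j then LinearMap.proj j + (1 / 2 : ℝ) • LinearMap.proj k
    else if l = k then LinearMap.proj j - (1 / 2 : ℝ) • LinearMap.proj k
    else LinearMap.proj l

theorem pairLinear_apply (j k : Fin N) (x : Config N) :
    pairLinear j k x = pairPath j k (x j) x (x k) := by
  ext l : 1
  simp only [pairLinear, LinearMap.pi_apply, pairPath]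
  split_ifs <;> rfl

theorem pairLinear_injective (hjk : j ≠ k) : Function.Injective (pairLinear j k) := by
  rw [← LinearMap.ker_eq_bot, LinearMap.ker_eq_bot']
  intro x hx
  have hl : ∀ l, pairPath j k (x j) x (x k) l = 0 := fun l =>
    congrFun ((pairLinear_apply j k x).symm.trans hx) l
  have hadd : x j + (1 / 2 : ℝ) • x k = 0 := (pairPath_left ..).symm.trans (hl j)
  have hsub : x j - (1 / 2 : ℝ) • x k = 0 := (pairPath_right hjk ..).symm.trans (hl k)
  ext l : 1
  by_cases hlj : l = j
  · rw [hlj, Pi.zero_apply]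
    linear_combination (norm := module) (1 / 2 : ℝ) • hadd + (1 / 2 : ℝ) • hsub
  by_cases hlk : l = k
  · rw [hlk, Pi.zero_apply]
    linear_combination (norm := module) hadd - hsub
  · exact (pairPath_of_ne hlj hlk ..).symm.trans (hl l)

theorem lintegral_le_of_pairPath (hjk : j ≠ k) {f g : Config N → ℝ≥0∞}
    (hf : Measurable f) (hg : Measurable g)
    (h : ∀ X x, ∫⁻ r, f (pairPath j k X x r) ≤ ∫⁻ r, g (pairPath j k X x r)) :
    ∫⁻ x, f x ≤ ∫⁻ x, g x := by
  have hL : Measurable (pairLinear j k) :=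
    (LinearMap.continuous_of_finiteDimensional _).measurable
  have hdet : LinearMap.det (pairLinear j k) ≠ 0 :=
    (LinearMap.isUnit_det _ ((LinearMap.isUnit_iff_ker_eq_bot _).2
      (LinearMap.ker_eq_bot.2 (pairLinear_injective hjk)))).ne_zero
  have slice : ∀ (x : Config N) r,
      pairLinear j k (Function.update x k r) = pairPath j k (x j) x r := fun x r => by
    rw [pairLinear_apply, Function.update_of_ne hjk, Function.update_self]
    ext l : 1
    by_cases hlj : l = j <;> by_cases hlk : l = k <;> simp [pairPath, hlj, hlk]
  have hcomp : ∫⁻ x, f (pairLinear j k x) ≤ ∫⁻ x, g (pairLinear j k x) := by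
    refine lintegral_le_of_lmarginal_le (μ := fun _ => (volume : Measure Plane)) {k} (hf.comp hL)
      (hg.comp hL) fun x => ?_
    simpa only [lmarginal_singleton, Function.comp_apply, slice] using h (x j) x
  rw [← lintegral_map hf hL, ← lintegral_map hg hL,
    Measure.map_linearMap_addHaar_eq_smul_addHaar _ hdet, lintegral_smul_measure,
    lintegral_smul_measure, smul_eq_mul, smul_eq_mul] at hcomp
  exact (ENNReal.mul_le_mul_iff_right (by simpa using hdet) ENNReal.ofReal_ne_top).1 hcomp

/-- The velocity of `pairPath j k`. -/
def pairDirection (j k : Fin N) : Plane →L[ℝ] Config N :=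
  (1 / 2 : ℝ) • (ContinuousLinearMap.single ℝ (fun _ : Fin N => Plane) j -
    ContinuousLinearMap.single ℝ (fun _ : Fin N => Plane) k)

theorem pairPath_eq_add (hjk : j ≠ k) (X : Plane) (x : Config N) :
    pairPath j k X x = fun r => pairPath j k X x 0 + pairDirection j k r := by
  ext r l : 2
  rcases eq_or_ne l j with rfl | hlj
  · simp [pairPath, pairDirection, hjk]
  rcases eq_or_ne l k with rfl | hlk
  · simp [pairPath, pairDirection, hlj, sub_eq_add_neg]
  · simp [pairPath, pairDirection, hlj, hlk]

theorem contDiff_pairPath (hjk : j ≠ k) (X : Plane) (x : Config N) :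
    ContDiff ℝ 1 (pairPath j k X x) := by
  rw [pairPath_eq_add hjk]
  fun_prop

theorem hasFDerivAt_pairPath (hjk : j ≠ k) (X : Plane) (x : Config N) (r : Plane) :
    HasFDerivAt (pairPath j k X x) (pairDirection j k) r := by
  rw [pairPath_eq_add hjk]
  exact (pairDirection j k).hasFDerivAt.const_add _

theorem pairPath_neg (hjk : j ≠ k) (X : Plane) (x : Config N) (r : Plane) :
    pairPath j k X x (-r) = pairPath j k X x r ∘ Equiv.swap j k := by
  ext l : 1
  rcases eq_or_ne l j with rfl | hlj
  · simp [pairPath, hjk.symm, sub_eq_add_neg]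
  rcases eq_or_ne l k with rfl | hlk
  · simp [pairPath, hlj]
  · simp [pairPath, hlj, hlk, Equiv.swap_apply_of_ne_of_ne]

variable {η : Config N → ℂ}

theorem covariantDeriv_comp_pairPath (hη : ContDiff ℝ 1 η) (hjk : j ≠ k) (α : ℝ) (X : Plane)
    (x : Config N) (r : Plane) :
    covariantDeriv (fun r => (α / 2) • (vectorPotential j (pairPath j k X x r) -
        vectorPotential k (pairPath j k X x r))) (fun r => η (pairPath j k X x r)) r =
      (1 / 2 : ℝ) • (momentum α j η (pairPath j k X x r) -
        momentum α k η (pairPath j k X x r)) := by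
  have chain : fderiv ℝ (fun r => η (pairPath j k X x r)) r =
      (fderiv ℝ η (pairPath j k X x r)).comp (pairDirection j k) :=
    ((hη.differentiable one_ne_zero _).hasFDerivAt.comp r
      (hasFDerivAt_pairPath hjk X x r)).fderiv
  ext a
  simp [covariantDeriv, momentum, chain, partialDeriv, pairDirection]
  ring

theorem IsCore.fluxGap_mul_lintegral_pairPath_le (hη : IsCore η) (α : ℝ) {δ : ℝ} (hδ : 0 ≤ δ)
    (hjk : j ≠ k) {X : Plane} {x : Config N} (hx : ∀ l, l ≠ j → l ≠ k → δ / 2 ≤ ‖X - x l‖) :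
    ENNReal.ofReal (fluxGap α) * ∫⁻ r in Metric.ball 0 δ, ‖η (pairPath j k X x r)‖ₑ ^ 2 ≤
      ENNReal.ofReal (δ ^ 2 / 4) * ∫⁻ r in Metric.ball 0 δ,
        (‖momentum α j η (pairPath j k X x r)‖ₑ ^ 2 +
          ‖momentum α k η (pairPath j k X x r)‖ₑ ^ 2) := by
  have hpath := contDiff_pairPath hjk X x
  have := hpath.continuous.measurable
  have hA : Measurable fun r => (α / 2) • (vectorPotential j (pairPath j k X x r) -
      vectorPotential k (pairPath j k X x r)) := by
    fun_prop
  have hδ' : ENNReal.ofReal (δ ^ 2 / 4) = ENNReal.ofReal (δ ^ 2 / 2) * ENNReal.ofReal (1 / 2) := by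
    rw [← ENNReal.ofReal_mul (by positivity)]
    ring_nf
  refine (fluxGap_mul_lintegral_ball_le hδ (hη.contDiff_one.comp hpath)
    (hη.eq_zero_of_eq hjk (by simp [pairPath, hjk.symm]))
    (fun r => by rw [Function.comp_apply, pairPath_neg hjk, hη.symmetric]; rfl) hA fun t ht htδ =>
      isFluxOn_pairPath hjk α ht fun l hj hk => by linarith [hx l hj hk]).trans ?_
  rw [hδ', mul_assoc, ← lintegral_const_mul' (ENNReal.ofReal (1 / 2)) _ ENNReal.ofReal_ne_top]
  refine mul_le_mul_right (lintegral_mono fun r => ?_) _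
  exact (congrArg (‖·‖ₑ ^ 2) (covariantDeriv_comp_pairPath hη.contDiff_one hjk α X x r)).trans_le
    (enorm_half_smul_sub_sq_le _ _)

theorem IsCore.fluxGap_mul_setLIntegral_le_of_pair (hη : IsCore η) (α : ℝ) {δ : ℝ} (hδ : 0 ≤ δ)
    (hjk : j ≠ k) {S : Set (Config N)} (hS : MeasurableSet S)
    (hball : ∀ X x, (pairPath j k X x ⁻¹' S).Nonempty → pairPath j k X x ⁻¹' S = Metric.ball 0 δ)
    (hfar : ∀ X x, (pairPath j k X x ⁻¹' S).Nonempty → ∀ l, l ≠ j → l ≠ k → δ / 2 ≤ ‖X - x l‖) :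
    ENNReal.ofReal (fluxGap α) * ∫⁻ x in S, ‖η x‖ₑ ^ 2 ≤ ENNReal.ofReal (δ ^ 2 / 4) *
      ∫⁻ x in S, (‖momentum α j η x‖ₑ ^ 2 + ‖momentum α k η x‖ₑ ^ 2) := by
  have hηm := hη.smooth.continuous.measurable
  have hDj := measurable_momentum hη.contDiff_one α j
  have hDk := measurable_momentum hη.contDiff_one α k
  rw [← lintegral_const_mul' _ _ ENNReal.ofReal_ne_top,
    ← lintegral_const_mul' _ _ ENNReal.ofReal_ne_top, ← lintegral_indicator hS,
    ← lintegral_indicator hS]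
  refine lintegral_le_of_pairPath hjk ((by fun_prop : Measurable _).indicator hS)
    ((by fun_prop : Measurable _).indicator hS) fun X x => ?_
  have hind : ∀ f : Config N → ℝ≥0∞, ∫⁻ r, S.indicator f (pairPath j k X x r) =
      ∫⁻ r in pairPath j k X x ⁻¹' S, f (pairPath j k X x r) := fun f =>
    lintegral_indicator ((contDiff_pairPath hjk X x).continuous.measurable hS) _
  rw [hind, hind]
  rcases Set.eq_empty_or_nonempty (pairPath j k X x ⁻¹' S) with hempty | hne
  · simp [hempty]
  · rw [hball X x hne, lintegral_const_mul' _ _ ENNReal.ofReal_ne_top,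
      lintegral_const_mul' _ _ ENNReal.ofReal_ne_top]
    exact hη.fluxGap_mul_lintegral_pairPath_le α hδ hjk (hfar X x hne)

end PairIntegral

theorem le_two_mul_of_le_add_half {a b : ℝ≥0∞} (ha : a ≠ ⊤) (h : a ≤ b + 2⁻¹ * a) : a ≤ 2 * b := by
  have half : 2⁻¹ * a + 2⁻¹ * a = a := by rw [← add_mul, ENNReal.inv_two_add_inv_two, one_mul]
  have habs : 2⁻¹ * a ≤ b :=
    (ENNReal.add_le_add_iff_right (by finiteness : 2⁻¹ * a ≠ ⊤)).1 (half.trans_le h)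
  calc a = 2 * (2⁻¹ * a) := by rw [two_mul, half]
    _ ≤ 2 * b := by gcongr

section Slice

theorem setLIntegral_le_of_forall_le_add {X : Type*} [MeasurableSpace X] {μ : Measure X}
    {v : X → ℝ≥0∞} {I J : Set X} {M c : ℝ≥0∞} (hI : MeasurableSet I) (hJ : MeasurableSet J)
    (hJtop : μ J ≠ ⊤) (hvol : μ I ≤ M * μ J) (h : ∀ s ∈ J, ∀ s' ∈ I, v s' ≤ v s + c) :
    ∫⁻ s in I, v s ∂μ ≤ M * (∫⁻ s in J, v s ∂μ) + μ I * c := by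
  rcases eq_or_ne (μ J) 0 with hJ0 | hJ0
  · have hI0 : μ I = 0 := by simpa [hJ0] using hvol
    simp [Measure.restrict_eq_zero.2 hI0]
  have average : ∀ s' ∈ I, μ J * v s' ≤ (∫⁻ s in J, v s ∂μ) + μ J * c := fun s' hs' =>
    calc μ J * v s' = ∫⁻ _ in J, v s' ∂μ := by rw [setLIntegral_const, mul_comm]
      _ ≤ ∫⁻ s in J, (v s + c) ∂μ := setLIntegral_mono' hJ fun s hs => h s hs s' hs'
      _ = _ := by rw [lintegral_add_right _ measurable_const, setLIntegral_const, mul_comm c]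
  refine (ENNReal.mul_le_mul_iff_right hJ0 hJtop).1 ?_
  calc μ J * ∫⁻ s in I, v s ∂μ = ∫⁻ s in I, μ J * v s ∂μ := (lintegral_const_mul' _ _ hJtop).symm
    _ ≤ ∫⁻ _ in I, ((∫⁻ s in J, v s ∂μ) + μ J * c) ∂μ := setLIntegral_mono' hI average
    _ = μ I * (∫⁻ s in J, v s ∂μ) + μ I * (μ J * c) := by rw [setLIntegral_const]; ring
    _ ≤ (M * μ J) * (∫⁻ s in J, v s ∂μ) + μ I * (μ J * c) := by gcongr
    _ = _ := by ring

theorem lintegral_sq_le_of_sq_le_add {p q : ℝ → ℝ≥0∞} (hp : Measurable p) {I J : Set ℝ}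
    (hI : MeasurableSet I) (hJ : MeasurableSet J) (hJI : J ⊆ I) (hItop : volume I ≠ ⊤)
    (hvol : volume I ≤ 8 * volume J) (hfin : ∫⁻ s in I, p s ^ 2 ≠ ⊤)
    (h : ∀ s ∈ I, ∀ s' ∈ I, p s' ^ 2 ≤ p s ^ 2 + ∫⁻ τ in I, 2 * (p τ * q τ)) :
    ∫⁻ s in I, p s ^ 2 ≤ 16 * (∫⁻ s in J, p s ^ 2) + 4 * volume I ^ 2 * ∫⁻ s in I, q s ^ 2 := by
  rcases eq_or_ne (volume I) 0 with hI0 | hI0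
  · simp [Measure.restrict_eq_zero.2 hI0]
  have average := setLIntegral_le_of_forall_le_add hI hJ (measure_ne_top_of_subset hJI hItop) hvol
    fun s hs s' hs' => h s (hJI hs) s' hs'
  have young : ∀ s, volume I * (2 * (p s * q s)) ≤
      2⁻¹ * p s ^ 2 + 2 * volume I ^ 2 * q s ^ 2 := fun s => by
    have := two_mul_mul_le_young (mul_ne_zero two_ne_zero hI0) (by finiteness) (p s) (q s)
    calc volume I * (2 * (p s * q s))
        ≤ volume I * ((2 * volume I)⁻¹ * p s ^ 2 + 2 * volume I * q s ^ 2) := by gcongr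
      _ = volume I * (volume I)⁻¹ * (2⁻¹ * p s ^ 2) + 2 * volume I ^ 2 * q s ^ 2 := by
          rw [ENNReal.mul_inv (by simp) (by simp)]
          ring
      _ = _ := by rw [ENNReal.mul_inv_cancel hI0 hItop, one_mul]
  have cross : volume I * ∫⁻ τ in I, 2 * (p τ * q τ) ≤
      2⁻¹ * (∫⁻ s in I, p s ^ 2) + 2 * volume I ^ 2 * ∫⁻ s in I, q s ^ 2 := by
    rw [← lintegral_const_mul' _ _ hItop, ← lintegral_const_mul' _ _ (by finiteness),
      ← lintegral_const_mul' _ _ (by finiteness),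
      ← lintegral_add_left (by fun_prop : Measurable fun s => 2⁻¹ * p s ^ 2)]
    exact lintegral_mono young
  refine (le_two_mul_of_le_add_half hfin ((average.trans (add_le_add_right cross _)).trans_eq
    ?_)).trans_eq (?_ : 2 * (8 * (∫⁻ s in J, p s ^ 2) +
      2 * volume I ^ 2 * ∫⁻ s in I, q s ^ 2) = _) <;> ring

/-- The point of the plane whose coordinate `a` is `s` and whose other coordinate is `t`. -/
def slicePoint (a : Fin 2) (s t : ℝ) : Plane := if a = 0 then !₂[s, t] else !₂[t, s]

@[simp] theorem slicePoint_self (a : Fin 2) (s t : ℝ) : slicePoint a s t a = s := by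
  fin_cases a <;> simp [slicePoint]

theorem slicePoint_of_ne {a b : Fin 2} (hab : b ≠ a) (s t : ℝ) : slicePoint a s t b = t := by
  fin_cases a <;> fin_cases b <;> simp_all [slicePoint]

theorem slicePoint_eq_add (a : Fin 2) (s t : ℝ) :
    slicePoint a s t = slicePoint a 0 t + s • (EuclideanSpace.single a 1 : Plane) := by
  ext b
  fin_cases a <;> fin_cases b <;> simp [slicePoint]

theorem hasDerivAt_slicePoint (a : Fin 2) (s t : ℝ) :
    HasDerivAt (slicePoint a · t) (EuclideanSpace.single a 1) s := by
  rw [show (slicePoint a · t) = _ from funext fun s => slicePoint_eq_add a s t]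
  simpa using ((hasDerivAt_id s).smul_const (EuclideanSpace.single a 1 : Plane)).const_add
    (slicePoint a 0 t)

theorem lintegral_slicePoint {f : Plane → ℝ≥0∞} (hf : Measurable f) (a : Fin 2) :
    ∫⁻ z, f z = ∫⁻ t, ∫⁻ s, f (slicePoint a s t) := by
  rw [lintegral_plane, Measure.volume_eq_prod]
  have hm : Measurable fun p : ℝ × ℝ => f !₂[p.1, p.2] := hf.comp (by fun_prop)
  fin_cases a
  · rw [lintegral_prod_symm _ hm.aemeasurable]
    simp [slicePoint]
  · rw [lintegral_prod _ hm.aemeasurable]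
    simp [slicePoint]

variable {N : ℕ}

theorem lintegral_le_of_slice (j : Fin N) (a : Fin 2) {f g : Config N → ℝ≥0∞}
    (hf : Measurable f) (hg : Measurable g)
    (h : ∀ x t, ∫⁻ s, f (Function.update x j (slicePoint a s t)) ≤
      ∫⁻ s, g (Function.update x j (slicePoint a s t))) :
    ∫⁻ x, f x ≤ ∫⁻ x, g x := by
  refine lintegral_le_of_lmarginal_le (μ := fun _ => (volume : Measure Plane)) {j} hf hg fun x => ?_
  simp only [lmarginal_singleton]
  rw [lintegral_slicePoint (f := fun z => f (Function.update x j z))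
      (hf.comp (measurable_update x)) a,
    lintegral_slicePoint (f := fun z => g (Function.update x j z))
      (hg.comp (measurable_update x)) a]
  exact lintegral_mono fun t => h x t

theorem hasDerivAt_update_slicePoint (x : Config N) (j : Fin N) (a : Fin 2) (s t : ℝ) :
    HasDerivAt (fun s => Function.update x j (slicePoint a s t))
      (Pi.single j (EuclideanSpace.single a 1)) s := by
  refine hasDerivAt_pi.2 fun l => ?_
  rcases eq_or_ne l j with rfl | hl
  · simpa using hasDerivAt_slicePoint a s t
  · simpa [hl] using hasDerivAt_const s (x l)

theorem continuous_update_slicePoint (x : Config N) (j : Fin N) (a : Fin 2) (t : ℝ) :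
    Continuous fun s => Function.update x j (slicePoint a s t) :=
  continuous_iff_continuousAt.2 fun s => (hasDerivAt_update_slicePoint x j a s t).continuousAt

variable {η : Config N → ℂ}

theorem enorm_sq_le_add_lintegral_slice (hη : ContDiff ℝ 1 η) (α : ℝ) (j : Fin N) (a : Fin 2)
    (x : Config N) (t s s' : ℝ) :
    ‖η (Function.update x j (slicePoint a s' t))‖ₑ ^ 2 ≤
      ‖η (Function.update x j (slicePoint a s t))‖ₑ ^ 2 +
      ∫⁻ τ in Set.uIoc s s', 2 * (‖η (Function.update x j (slicePoint a τ t))‖ₑ *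
        ‖momentum α j η (Function.update x j (slicePoint a τ t))‖ₑ) := by
  set γ : ℝ → Config N := fun τ => Function.update x j (slicePoint a τ t)
  have hu : ∀ τ, HasDerivAt (η ∘ γ) (partialDeriv j a η (γ τ)) τ := fun τ =>
    (hη.differentiable one_ne_zero (γ τ)).hasFDerivAt.comp_hasDerivAt τ
      (hasDerivAt_update_slicePoint x j a τ t)
  have coord : ∀ τ, ‖-Complex.I * partialDeriv j a η (γ τ) +
      ((α * vectorPotential j (γ τ) a : ℝ) : ℂ) * η (γ τ)‖ₑ ≤ ‖momentum α j η (γ τ)‖ₑ := fun τ => by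
    rw [enorm_le_iff_norm_le]
    simpa [momentum] using PiLp.norm_apply_le (momentum α j η (γ τ)) a
  refine (enorm_sq_le_add_lintegral_momentum hu ((continuous_partialDeriv hη j a).comp
    (continuous_update_slicePoint x j a t)) (fun τ => α * vectorPotential j (γ τ) a) s s').trans ?_
  exact add_le_add_right (lintegral_mono fun τ =>
    mul_le_mul_right (mul_le_mul_right (coord τ) _) _) _

end Slice

section Square

variable {N : ℕ} {η : Config N → ℂ}

theorem IsCore.lintegral_enorm_sq_slice_le (hη : IsCore η) (α : ℝ) (j : Fin N) (a : Fin 2)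
    {I J : Set ℝ} (hI : MeasurableSet I) (hJ : MeasurableSet J) (hIc : I.OrdConnected)
    (hJI : J ⊆ I) (hItop : volume I ≠ ⊤) (hvol : volume I ≤ 8 * volume J) (x : Config N) (t : ℝ) :
    ∫⁻ s in I, ‖η (Function.update x j (slicePoint a s t))‖ₑ ^ 2 ≤
      16 * (∫⁻ s in J, ‖η (Function.update x j (slicePoint a s t))‖ₑ ^ 2) +
      4 * volume I ^ 2 *
        ∫⁻ s in I, ‖momentum α j η (Function.update x j (slicePoint a s t))‖ₑ ^ 2 := by
  have hγ := continuous_update_slicePoint x j a t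
  refine lintegral_sq_le_of_sq_le_add (p := fun s => ‖η (Function.update x j (slicePoint a s t))‖ₑ)
    (hη.smooth.continuous.comp hγ).measurable.enorm hI hJ hJI hItop hvol ?_ fun s hs s' hs' => ?_
  · obtain ⟨C, hC⟩ := hη.smooth.continuous.bounded_above_of_compact_support hη.compact
    refine ne_top_of_le_ne_top (b := ENNReal.ofReal C ^ 2 * volume I) (by finiteness) ?_
    rw [← setLIntegral_const]
    gcongr
    rw [← ofReal_norm]
    exact ENNReal.ofReal_le_ofReal (hC _)
  · exact (enorm_sq_le_add_lintegral_slice hη.contDiff_one α j a x t s s').trans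
      (add_le_add_right (lintegral_mono_set
        (Set.uIoc_subset_uIcc.trans (hIc.uIcc_subset hs hs'))) _)

theorem setLIntegral_le_of_slice (j : Fin N) (a : Fin 2) {I J : Set ℝ} (hJ : MeasurableSet J)
    (hJI : J ⊆ I) {A : Set (Config N)} (hA : MeasurableSet A) (hAI : ∀ x ∈ A, x j a ∈ I)
    (hAu : ∀ x s s' t, Function.update x j (slicePoint a s t) ∈ A → s' ∈ I →
      Function.update x j (slicePoint a s' t) ∈ A)
    {f g : Config N → ℝ≥0∞} (hf : Measurable f) (hg : Measurable g) {K L : ℝ≥0∞}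
    (h : ∀ x t, ∫⁻ s in I, f (Function.update x j (slicePoint a s t)) ≤
      K * (∫⁻ s in J, f (Function.update x j (slicePoint a s t))) +
        L * ∫⁻ s in I, g (Function.update x j (slicePoint a s t))) :
    ∫⁻ x in A, f x ≤ K * (∫⁻ x in A ∩ {x | x j a ∈ J}, f x) + L * ∫⁻ x in A, g x := by
  have hAJ : MeasurableSet (A ∩ {x : Config N | x j a ∈ J}) :=
    hA.inter (hJ.preimage (by fun_prop : Measurable fun x : Config N => x j a))
  have hfAJ := (hf.indicator hAJ).const_mul K
  have hgA := (hg.indicator hA).const_mul L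
  rw [← lintegral_indicator hA, ← lintegral_indicator hA, ← lintegral_indicator hAJ,
    ← lintegral_const_mul _ (hf.indicator hAJ), ← lintegral_const_mul _ (hg.indicator hA),
    ← lintegral_add_left hfAJ]
  refine lintegral_le_of_slice j a (hf.indicator hA) (hfAJ.add hgA) fun x t => ?_
  set γ : ℝ → Config N := fun s => Function.update x j (slicePoint a s t) with hγ
  have hγm : Measurable γ := (continuous_update_slicePoint x j a t).measurable
  have hind : ∀ {B : Set (Config N)}, MeasurableSet B → ∀ u : Config N → ℝ≥0∞,
      ∫⁻ s, B.indicator u (γ s) = ∫⁻ s in γ ⁻¹' B, u (γ s) := fun hB u =>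
    lintegral_indicator (hγm hB) _
  have hfγ : Measurable fun s => (A ∩ {x : Config N | x j a ∈ J}).indicator f (γ s) :=
    (hf.indicator hAJ).comp hγm
  have hgγ : Measurable fun s => A.indicator g (γ s) := (hg.indicator hA).comp hγm
  rw [lintegral_add_left (hfγ.const_mul K), lintegral_const_mul _ hfγ, lintegral_const_mul _ hgγ,
    hind hA, hind hA, hind hAJ]
  rcases Set.eq_empty_or_nonempty (γ ⁻¹' A) with hempty | ⟨s₀, hs₀⟩
  · simp [hempty]
  have hAγ : γ ⁻¹' A = I := Set.ext fun s =>
    ⟨fun h => by simpa [hγ] using hAI _ h, hAu x s₀ s t hs₀⟩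
  have hJγ : γ ⁻¹' (A ∩ {x : Config N | x j a ∈ J}) = J := by
    rw [Set.preimage_inter, hAγ]
    simpa [hγ] using hJI
  rw [hAγ, hJγ]
  exact h x t

/-- The half-open square with lower left corner `c` and side `ℓ`; half-open so that squares can be
cut into disjoint smaller ones. -/
def square (c : Plane) (ℓ : ℝ) : Set Plane := {z | ∀ a, z a ∈ Set.Ico (c a) (c a + ℓ)}

theorem measurableSet_square (c : Plane) (ℓ : ℝ) : MeasurableSet (square c ℓ) := by
  simp only [square, Set.ofPred_forall]
  exact MeasurableSet.iInter fun a => measurableSet_Ico.preimage (by fun_prop)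

theorem slicePoint_mem_square {c : Plane} {ℓ : ℝ} {a : Fin 2} {s s' t : ℝ}
    (h : slicePoint a s t ∈ square c ℓ) (hs' : s' ∈ Set.Ico (c a) (c a + ℓ)) :
    slicePoint a s' t ∈ square c ℓ := by
  intro b
  rcases eq_or_ne b a with rfl | hb
  · simpa using hs'
  · simpa only [slicePoint_of_ne hb] using h b

theorem IsCore.setLIntegral_enorm_sq_le_of_strip (hη : IsCore η) (α : ℝ) (j : Fin N) (a : Fin 2)
    {c : Plane} {c' ℓ ℓ' : ℝ} (hℓ : ℓ ≤ 8 * ℓ') (hc : c a ≤ c') (hc' : c' + ℓ' ≤ c a + ℓ)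
    {A : Set (Config N)} (hA : MeasurableSet A) (hAQ : ∀ x ∈ A, x j ∈ square c ℓ)
    (hAu : ∀ x s s' t, Function.update x j (slicePoint a s t) ∈ A →
      slicePoint a s' t ∈ square c ℓ → Function.update x j (slicePoint a s' t) ∈ A) :
    ∫⁻ x in A, ‖η x‖ₑ ^ 2 ≤
      16 * (∫⁻ x in A ∩ {x | x j a ∈ Set.Ico c' (c' + ℓ')}, ‖η x‖ₑ ^ 2) +
      4 * ENNReal.ofReal ℓ ^ 2 * ∫⁻ x in A, ‖momentum α j η x‖ₑ ^ 2 := by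
  have hvol : ∀ p q : ℝ, volume (Set.Ico p (p + q)) = ENNReal.ofReal q := fun p q => by simp
  have hJI : Set.Ico c' (c' + ℓ') ⊆ Set.Ico (c a) (c a + ℓ) := Set.Ico_subset_Ico hc hc'
  have hvol8 : volume (Set.Ico (c a) (c a + ℓ)) ≤ 8 * volume (Set.Ico c' (c' + ℓ')) := by
    rw [hvol, hvol, ← ENNReal.ofReal_ofNat 8, ← ENNReal.ofReal_mul (by norm_num)]
    exact ENNReal.ofReal_le_ofReal hℓ
  refine setLIntegral_le_of_slice j a measurableSet_Ico hJI hA (fun x hx => hAQ x hx a)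
    (fun x s s' t hx hs' => hAu x s s' t hx (slicePoint_mem_square (by simpa using hAQ _ hx) hs'))
    (hη.smooth.continuous.measurable.enorm.pow_const 2)
    ((measurable_momentum hη.contDiff_one α j).enorm.pow_const 2) fun x t => ?_
  simpa only [hvol] using hη.lintegral_enorm_sq_slice_le α j a measurableSet_Ico measurableSet_Ico
    Set.ordConnected_Ico hJI measure_Ico_lt_top.ne hvol8 x t

theorem IsCore.setLIntegral_enorm_sq_le_of_square (hη : IsCore η) (α : ℝ) (j : Fin N)
    {c c' : Plane} {ℓ ℓ' : ℝ} (hℓ : ℓ ≤ 8 * ℓ') (hc : ∀ a, c a ≤ c' a)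
    (hc' : ∀ a, c' a + ℓ' ≤ c a + ℓ) {A : Set (Config N)} (hA : MeasurableSet A)
    (hAQ : ∀ x ∈ A, x j ∈ square c ℓ)
    (hAu : ∀ x ∈ A, ∀ z ∈ square c ℓ, Function.update x j z ∈ A) :
    ∫⁻ x in A, ‖η x‖ₑ ^ 2 ≤ 256 * ((∫⁻ x in A ∩ {x | x j ∈ square c' ℓ'}, ‖η x‖ₑ ^ 2) +
      ENNReal.ofReal ℓ ^ 2 * ∫⁻ x in A, ‖momentum α j η x‖ₑ ^ 2) := by
  have hAu' : ∀ {a : Fin 2} (x : Config N) (s s' t : ℝ),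
      Function.update x j (slicePoint a s t) ∈ A → slicePoint a s' t ∈ square c ℓ →
      Function.update x j (slicePoint a s' t) ∈ A := fun x s s' t hx hz => by
    simpa using hAu _ hx _ hz
  set A' := A ∩ {x : Config N | x j 0 ∈ Set.Ico (c' 0) (c' 0 + ℓ')}
  have hA' : MeasurableSet A' := hA.inter
    (measurableSet_Ico.preimage (by fun_prop : Measurable fun x : Config N => x j 0))
  have first := hη.setLIntegral_enorm_sq_le_of_strip α j 0 hℓ (hc 0) (hc' 0) hA hAQ hAu'
  have second := hη.setLIntegral_enorm_sq_le_of_strip α j 1 hℓ (hc 1) (hc' 1) hA'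
    (fun x hx => hAQ x hx.1) fun x s s' t hx hz => ⟨hAu' x s s' t hx.1 hz, by
      simpa [slicePoint_of_ne (show (0 : Fin 2) ≠ 1 by decide)] using hx.2⟩
  have hset : A' ∩ {x : Config N | x j 1 ∈ Set.Ico (c' 1) (c' 1 + ℓ')} =
      A ∩ {x | x j ∈ square c' ℓ'} := by
    ext x
    simp [A', square, Fin.forall_fin_two, and_assoc]
  rw [hset] at second
  set T := ∫⁻ x in A, ‖momentum α j η x‖ₑ ^ 2
  set P := ∫⁻ x in A ∩ {x | x j ∈ square c' ℓ'}, ‖η x‖ₑ ^ 2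
  calc _ ≤ 16 * (16 * P + 4 * ENNReal.ofReal ℓ ^ 2 * T) + 4 * ENNReal.ofReal ℓ ^ 2 * T := by
        refine first.trans ?_
        gcongr
        refine second.trans ?_
        gcongr
        exact lintegral_mono_set Set.inter_subset_left
    _ = 256 * P + 68 * (ENNReal.ofReal ℓ ^ 2 * T) := by ring
    _ ≤ 256 * P + 256 * (ENNReal.ofReal ℓ ^ 2 * T) := by gcongr; norm_num
    _ = _ := by ring

end Square

section LocalExclusion

variable {N : ℕ}

/-- A set of configurations, with exactly the particles in `S` inside the region `Q`, which does
not restrict the positions of these particles within `Q`. -/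
structure IsSector (Q : Set Plane) (S : Finset (Fin N)) (A : Set (Config N)) : Prop where
  measurableSet : MeasurableSet A
  mem_iff : ∀ x ∈ A, ∀ j, x j ∈ Q ↔ j ∈ S
  update_mem : ∀ x ∈ A, ∀ j ∈ S, ∀ z ∈ Q, Function.update x j z ∈ A

theorem measurableSet_forall_mem_square (U : Finset (Fin N)) (c : Fin N → Plane)
    (ℓ : Fin N → ℝ) : MeasurableSet {x : Config N | ∀ l ∈ U, x l ∈ square (c l) (ℓ l)} := by
  simp only [Set.ofPred_forall]
  exact Finset.measurableSet_biInter _ fun l _ =>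
    (measurableSet_square _ _).preimage (measurable_pi_apply l)

theorem IsCore.setLIntegral_enorm_sq_le_of_isSector {η : Config N → ℂ} (hη : IsCore η) (α : ℝ)
    {c : Plane} {ℓ : ℝ} {S : Finset (Fin N)} {A : Set (Config N)} (hA : IsSector (square c ℓ) S A)
    {c' : Fin N → Plane} {ℓ' : Fin N → ℝ} (hℓ : ∀ l, ℓ ≤ 8 * ℓ' l) (hc : ∀ l a, c a ≤ c' l a)
    (hc' : ∀ l a, c' l a + ℓ' l ≤ c a + ℓ) {U : Finset (Fin N)} (hU : U ⊆ S) :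
    ∫⁻ x in A, ‖η x‖ₑ ^ 2 ≤ 256 ^ U.card *
      ((∫⁻ x in A ∩ {x | ∀ l ∈ U, x l ∈ square (c' l) (ℓ' l)}, ‖η x‖ₑ ^ 2) +
        ENNReal.ofReal ℓ ^ 2 * ∑ l ∈ U, ∫⁻ x in A, ‖momentum α l η x‖ₑ ^ 2) := by
  induction U using Finset.induction_on with
  | empty => simp
  | insert u U hu ih =>
    obtain ⟨huS, hUS⟩ := Finset.insert_subset_iff.1 hU
    set B := A ∩ {x : Config N | ∀ l ∈ U, x l ∈ square (c' l) (ℓ' l)} with hB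
    have hBm : MeasurableSet B := hA.measurableSet.inter (measurableSet_forall_mem_square _ _ _)
    have move := hη.setLIntegral_enorm_sq_le_of_square α u (hℓ u) (hc u) (hc' u) hBm
      (fun x hx => (hA.mem_iff x hx.1 u).2 huS) (fun x hx z hz =>
        ⟨hA.update_mem x hx.1 u huS z hz, fun l hl => by
          rw [Function.update_of_ne (ne_of_mem_of_not_mem hl hu)]; exact hx.2 l hl⟩)
    have hset : B ∩ {x | x u ∈ square (c' u) (ℓ' u)} =
        A ∩ {x | ∀ l ∈ insert u U, x l ∈ square (c' l) (ℓ' l)} := by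
      ext x
      simp only [hB, Set.mem_inter_iff, Set.mem_ofPred_eq, Finset.forall_mem_insert]
      tauto
    rw [hset] at move
    have hD : ∫⁻ x in B, ‖momentum α u η x‖ₑ ^ 2 ≤ ∫⁻ x in A, ‖momentum α u η x‖ₑ ^ 2 :=
      lintegral_mono_set Set.inter_subset_left
    rw [Finset.card_insert_of_notMem hu, Finset.sum_insert hu]
    set P := ∫⁻ x in A ∩ {x | ∀ l ∈ insert u U, x l ∈ square (c' l) (ℓ' l)}, ‖η x‖ₑ ^ 2
    set T := ∑ l ∈ U, ∫⁻ x in A, ‖momentum α l η x‖ₑ ^ 2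
    set Du := ∫⁻ x in A, ‖momentum α u η x‖ₑ ^ 2
    calc _ ≤ 256 ^ U.card * ((256 * (P + ENNReal.ofReal ℓ ^ 2 * Du)) +
          1 * (ENNReal.ofReal ℓ ^ 2 * T)) := by
            rw [one_mul]
            refine (ih hUS).trans ?_
            gcongr
            refine move.trans ?_
            gcongr
      _ ≤ 256 ^ U.card * ((256 * (P + ENNReal.ofReal ℓ ^ 2 * Du)) +
          256 * (ENNReal.ofReal ℓ ^ 2 * T)) := by gcongr; norm_num
      _ = _ := by rw [pow_succ]; ring

theorem abs_apply_le_norm (z : Plane) (a : Fin 2) : |z a| ≤ ‖z‖ := PiLp.norm_apply_le z a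

theorem norm_le_abs_add_abs (z : Plane) : ‖z‖ ≤ |z 0| + |z 1| := by
  rw [EuclideanSpace.norm_eq, Fin.sum_univ_two, Real.sqrt_le_iff]
  refine ⟨by positivity, ?_⟩
  simp only [Real.norm_eq_abs]
  nlinarith [abs_nonneg (z 0), abs_nonneg (z 1)]

theorem pairPath_mem_of_isSector {Q : Set Plane} {S : Finset (Fin N)} {A : Set (Config N)}
    (hA : IsSector Q S A) {j k : Fin N} (hj : j ∈ S) (hk : k ∈ S) {X : Plane} {x : Config N}
    {r r' : Plane} (h : pairPath j k X x r ∈ A) (hadd : X + (1 / 2 : ℝ) • r' ∈ Q)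
    (hsub : X - (1 / 2 : ℝ) • r' ∈ Q) : pairPath j k X x r' ∈ A := by
  convert hA.update_mem _ (hA.update_mem _ h k hk _ hsub) j hj _ hadd using 1
  ext l : 1
  by_cases hlj : l = j <;> by_cases hlk : l = k <;> simp [pairPath, Function.update_apply, hlj, hlk]

/-- The translate of the corner `c` of a square by `s` along its diagonal. -/
def cornerShift (c : Plane) (s : ℝ) : Plane := WithLp.toLp 2 fun a => c a + s

@[simp] theorem cornerShift_apply (c : Plane) (s : ℝ) (a : Fin 2) : cornerShift c s a = c a + s :=
  rfl

/-- The configurations in `A` for which the midpoint of the particles `j` and `k` lies in a small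
central square, these two are closer to each other than `ℓ / 4`, and the other particles of `S`
lie in the upper right quarter of `square c ℓ`, hence at distance at least `ℓ / 8` from that
midpoint. -/
def closePair (A : Set (Config N)) (S : Finset (Fin N)) (c : Plane) (ℓ : ℝ) (j k : Fin N) :
    Set (Config N) :=
  {x ∈ A | (1 / 2 : ℝ) • (x j + x k) ∈ square (cornerShift c (ℓ / 4)) (ℓ / 8) ∧
    (∀ l ∈ (S.erase j).erase k, x l ∈ square (cornerShift c (ℓ / 2)) (ℓ / 2)) ∧
    ‖x j - x k‖ < ℓ / 4}

variable {A : Set (Config N)} {S : Finset (Fin N)} {c : Plane} {ℓ : ℝ} {j k : Fin N}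

theorem measurableSet_closePair (hA : MeasurableSet A) : MeasurableSet (closePair A S c ℓ j k) :=
  hA.inter <| .inter ((measurableSet_square _ _).preimage
    (by fun_prop : Measurable fun x : Config N => (1 / 2 : ℝ) • (x j + x k))) <|
    (measurableSet_forall_mem_square _ (fun _ => _) fun _ => _).inter <|
    measurableSet_lt (by fun_prop : Measurable fun x : Config N => ‖x j - x k‖) measurable_const

theorem pairPath_mem_closePair (hjk : j ≠ k) {X : Plane} {x : Config N} {r : Plane} :
    pairPath j k X x r ∈ closePair A S c ℓ j k ↔ pairPath j k X x r ∈ A ∧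
      X ∈ square (cornerShift c (ℓ / 4)) (ℓ / 8) ∧
      (∀ l ∈ (S.erase j).erase k, x l ∈ square (cornerShift c (ℓ / 2)) (ℓ / 2)) ∧
      ‖r‖ < ℓ / 4 := by
  have midpoint : (1 / 2 : ℝ) • (pairPath j k X x r j + pairPath j k X x r k) = X := by
    rw [pairPath_left, pairPath_right hjk]; module
  have relative : pairPath j k X x r j - pairPath j k X x r k = r := by
    rw [pairPath_left, pairPath_right hjk]; module
  have others : (∀ l ∈ (S.erase j).erase k,
      pairPath j k X x r l ∈ square (cornerShift c (ℓ / 2)) (ℓ / 2)) ↔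
      ∀ l ∈ (S.erase j).erase k, x l ∈ square (cornerShift c (ℓ / 2)) (ℓ / 2) := by
    refine forall₂_congr fun l hl => ?_
    simp only [Finset.mem_erase] at hl
    rw [pairPath_of_ne hl.2.1 hl.1]
  simp only [closePair, Set.mem_ofPred_eq, midpoint, relative, others]

theorem preimage_pairPath_closePair (hA : IsSector (square c ℓ) S A) (hj : j ∈ S) (hk : k ∈ S)
    (hjk : j ≠ k) {X : Plane} {x : Config N}
    (hne : (pairPath j k X x ⁻¹' closePair A S c ℓ j k).Nonempty) :
    pairPath j k X x ⁻¹' closePair A S c ℓ j k = Metric.ball 0 (ℓ / 4) := by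
  obtain ⟨r₀, hr₀⟩ := hne
  obtain ⟨hmem, hX, hl, -⟩ := (pairPath_mem_closePair hjk).1 hr₀
  ext r
  rw [Set.mem_preimage, pairPath_mem_closePair hjk, mem_ball_zero_iff]
  refine ⟨fun h => h.2.2.2, fun hr => ⟨?_, hX, hl, hr⟩⟩
  refine pairPath_mem_of_isSector hA hj hk hmem (fun a => ?_) (fun a => ?_)
  all_goals
    have hXa := hX a
    have hra := abs_lt.1 ((abs_apply_le_norm r a).trans_lt hr)
    simp only [Set.mem_Ico, cornerShift_apply, PiLp.add_apply, PiLp.sub_apply, PiLp.smul_apply,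
      smul_eq_mul] at hXa ⊢
    constructor <;> linarith

theorem le_norm_sub_of_pairPath_mem_closePair (hA : IsSector (square c ℓ) S A) (hjk : j ≠ k)
    {X : Plane} {x : Config N} (hne : (pairPath j k X x ⁻¹' closePair A S c ℓ j k).Nonempty)
    {l : Fin N} (hlj : l ≠ j) (hlk : l ≠ k) : ℓ / 8 ≤ ‖X - x l‖ := by
  obtain ⟨r, hr⟩ := hne
  obtain ⟨hmem, hX, hother, -⟩ := (pairPath_mem_closePair hjk).1 hr
  suffices ∃ a, ℓ / 8 ≤ |(X - x l) a| from
    this.elim fun a ha => ha.trans (abs_apply_le_norm (X - x l) a)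
  simp only [PiLp.sub_apply]
  by_cases hlS : l ∈ S
  · have hx0 := hother l (by simp [hlS, hlj, hlk]) 0
    have hX0 := hX 0
    simp only [Set.mem_Ico, cornerShift_apply] at hx0 hX0
    refine ⟨0, ?_⟩
    rw [abs_sub_comm]
    exact le_trans (by linarith) (le_abs_self _)
  · have hout : x l ∉ square c ℓ := by
      have := mt (hA.mem_iff _ hmem l).1 hlS
      rwa [pairPath_of_ne hlj hlk] at this
    simp only [square, Set.mem_ofPred_eq, not_forall, Set.mem_Ico, not_and_or, not_le, not_lt]
      at hout
    obtain ⟨a, ha⟩ := hout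
    have hXa := hX a
    simp only [Set.mem_Ico, cornerShift_apply] at hXa
    refine ⟨a, ?_⟩
    rcases ha with ha | ha
    · exact le_trans (by linarith) (le_abs_self _)
    · rw [abs_sub_comm]
      exact le_trans (by linarith) (le_abs_self _)

theorem mem_closePair (hj : j ∈ S) (hk : k ∈ S) {x : Config N} (hxA : x ∈ A)
    (hx : ∀ l ∈ S, x l ∈ square (if l = j ∨ l = k then cornerShift c (ℓ / 4)
      else cornerShift c (ℓ / 2)) (if l = j ∨ l = k then ℓ / 8 else ℓ / 2)) :
    x ∈ closePair A S c ℓ j k := by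
  have hxj : x j ∈ square (cornerShift c (ℓ / 4)) (ℓ / 8) := by simpa using hx j hj
  have hxk : x k ∈ square (cornerShift c (ℓ / 4)) (ℓ / 8) := by simpa using hx k hk
  refine ⟨hxA, fun a => ?_, fun l hl => ?_, ?_⟩
  · have hja := hxj a
    have hka := hxk a
    simp only [Set.mem_Ico, PiLp.smul_apply, PiLp.add_apply, smul_eq_mul] at hja hka ⊢
    constructor <;> linarith
  · simp only [Finset.mem_erase] at hl
    simpa [hl.1, hl.2.1] using hx l hl.2.2
  · have hcoord : ∀ a, |(x j - x k) a| < ℓ / 8 := fun a => by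
      have hja := hxj a
      have hka := hxk a
      simp only [Set.mem_Ico] at hja hka
      rw [PiLp.sub_apply, abs_lt]
      constructor <;> linarith
    linarith [norm_le_abs_add_abs (x j - x k), hcoord 0, hcoord 1]

variable {η : Config N → ℂ}

theorem IsCore.fluxGap_mul_setLIntegral_closePair_le (hη : IsCore η) (α : ℝ) (hℓ : 0 ≤ ℓ)
    (hA : IsSector (square c ℓ) S A) (hj : j ∈ S) (hk : k ∈ S) (hjk : j ≠ k) :
    ENNReal.ofReal (fluxGap α) * ∫⁻ x in closePair A S c ℓ j k, ‖η x‖ₑ ^ 2 ≤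
      ENNReal.ofReal ℓ ^ 2 * ∑ j ∈ S, ∫⁻ x in A, ‖momentum α j η x‖ₑ ^ 2 := by
  have := measurable_momentum hη.contDiff_one α j
  refine (hη.fluxGap_mul_setLIntegral_le_of_pair α (by linarith : 0 ≤ ℓ / 4) hjk
    (measurableSet_closePair hA.measurableSet)
    (fun _ _ => preimage_pairPath_closePair hA hj hk hjk) fun X x hne l hlj hlk => by
      linarith [le_norm_sub_of_pairPath_mem_closePair hA hjk hne hlj hlk]).trans (mul_le_mul' ?_ ?_)
  · rw [← ENNReal.ofReal_pow hℓ]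
    exact ENNReal.ofReal_le_ofReal (by nlinarith)
  · have hBA : closePair A S c ℓ j k ⊆ A := fun x hx => hx.1
    rw [lintegral_add_left (by fun_prop), ← Finset.add_sum_erase _ _ hj,
      ← Finset.add_sum_erase _ _ (Finset.mem_erase.2 ⟨hjk.symm, hk⟩)]
    exact add_le_add (lintegral_mono_set hBA) (le_add_right (lintegral_mono_set hBA))

theorem IsCore.fluxGap_mul_setLIntegral_le_of_card_le_four (hη : IsCore η) (α : ℝ) (hℓ : 0 ≤ ℓ)
    (hA : IsSector (square c ℓ) S A) (hS : 2 ≤ S.card) (hS' : S.card ≤ 4) :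
    ENNReal.ofReal (fluxGap α) * ∫⁻ x in A, ‖η x‖ₑ ^ 2 ≤
      2 * 256 ^ 4 * (ENNReal.ofReal ℓ ^ 2 * ∑ j ∈ S, ∫⁻ x in A, ‖momentum α j η x‖ₑ ^ 2) := by
  obtain ⟨j, hj, k, hk, hjk⟩ := Finset.one_lt_card.1 hS
  have move := hη.setLIntegral_enorm_sq_le_of_isSector α hA
    (c' := fun l => if l = j ∨ l = k then cornerShift c (ℓ / 4) else cornerShift c (ℓ / 2))
    (ℓ' := fun l => if l = j ∨ l = k then ℓ / 8 else ℓ / 2)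
    (fun l => by split_ifs <;> linarith)
    (fun l a => by split_ifs <;> simp only [cornerShift_apply] <;> linarith)
    (fun l a => by split_ifs <;> simp only [cornerShift_apply] <;> linarith) subset_rfl
  have pair := hη.fluxGap_mul_setLIntegral_closePair_le α hℓ hA hj hk hjk
  have hP : ∫⁻ x in A ∩ {x | ∀ l ∈ S, x l ∈ square
      (if l = j ∨ l = k then cornerShift c (ℓ / 4) else cornerShift c (ℓ / 2))
      (if l = j ∨ l = k then ℓ / 8 else ℓ / 2)}, ‖η x‖ₑ ^ 2 ≤
      ∫⁻ x in closePair A S c ℓ j k, ‖η x‖ₑ ^ 2 :=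
    lintegral_mono_set fun x hx => mem_closePair hj hk hx.1 hx.2
  have hgap : ENNReal.ofReal (fluxGap α) ≤ 1 := by simpa using fluxGap_le_one α
  set P := ∫⁻ x in closePair A S c ℓ j k, ‖η x‖ₑ ^ 2
  set T := ∑ j ∈ S, ∫⁻ x in A, ‖momentum α j η x‖ₑ ^ 2
  calc _ ≤ ENNReal.ofReal (fluxGap α) * (256 ^ 4 * (P + ENNReal.ofReal ℓ ^ 2 * T)) := by
        gcongr
        refine move.trans ?_
        gcongr
        norm_num
    _ = 256 ^ 4 * (ENNReal.ofReal (fluxGap α) * P +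
        ENNReal.ofReal (fluxGap α) * (ENNReal.ofReal ℓ ^ 2 * T)) := by ring
    _ ≤ 256 ^ 4 * (ENNReal.ofReal ℓ ^ 2 * T + 1 * (ENNReal.ofReal ℓ ^ 2 * T)) := by gcongr
    _ = _ := by ring

end LocalExclusion

section DyadicSubdivision

variable {N : ℕ}

theorem IsCore.exists_separation {η : Config N → ℂ} (hη : IsCore η) :
    ∃ ε : ℝ, 0 < ε ∧ ∀ x, η x ≠ 0 → ∀ j k, j ≠ k → ∀ c ℓ, ℓ ≤ ε → x j ∈ square c ℓ →
      x k ∉ square c ℓ := by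
  have uniform : ∀ᶠ ε : ℝ in 𝓝[>] 0, ∀ j k : Fin N, j ≠ k →
      ∀ x ∈ tsupport η, 2 * ε < ‖x j - x k‖ := by
    simp only [eventually_all]
    intro j k hjk
    obtain ⟨d, hd, hle⟩ := hη.compact.isCompact.exists_forall_le' (a := (0 : ℝ))
      (f := fun x : Config N => ‖x j - x k‖) (by fun_prop)
      (fun x hx => norm_pos_iff.2 (sub_ne_zero.2 (hη.support hx j k hjk)))
    filter_upwards [nhdsWithin_le_nhds (gt_mem_nhds (half_pos hd))] with ε hε x hx
    linarith [hle x hx]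
  obtain ⟨ε, hε, hpos⟩ := (uniform.and self_mem_nhdsWithin).exists
  refine ⟨ε, hpos, fun x hx j k hjk c ℓ hℓ hj hk => ?_⟩
  have coord : ∀ a, |(x j - x k) a| ≤ ℓ := fun a => by
    have hja := hj a
    have hka := hk a
    simp only [Set.mem_Ico] at hja hka
    rw [PiLp.sub_apply, abs_le]
    constructor <;> linarith
  linarith [coord 0, coord 1, norm_le_abs_add_abs (x j - x k),
    hε j k hjk x (subset_tsupport η hx)]

theorem IsSector.setLIntegral_enorm_sq_eq_zero {Q : Set Plane} {S : Finset (Fin N)}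
    {A : Set (Config N)} (hA : IsSector Q S A) (hS : 1 < S.card) {η : Config N → ℂ}
    (hsep : ∀ x, η x ≠ 0 → ∀ j k, j ≠ k → x j ∈ Q → x k ∉ Q) : ∫⁻ x in A, ‖η x‖ₑ ^ 2 = 0 := by
  obtain ⟨j, hj, k, hk, hjk⟩ := Finset.one_lt_card.1 hS
  have hzero : ∀ x ∈ A, ‖η x‖ₑ ^ 2 = 0 := fun x hx => by
    by_contra hne
    exact hsep x (by simpa using hne) j k hjk ((hA.mem_iff x hx j).2 hj) ((hA.mem_iff x hx k).2 hk)
  simp [setLIntegral_congr_fun hA.measurableSet hzero]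

theorem setLIntegral_eq_sum_fibres {X ι : Type*} [MeasurableSpace X] {μ : Measure X} [Fintype ι]
    {g : X → ι} (hg : ∀ i, MeasurableSet (g ⁻¹' {i})) (A : Set X) (F : X → ℝ≥0∞) :
    ∫⁻ x in A, F x ∂μ = ∑ i, ∫⁻ x in A ∩ g ⁻¹' {i}, F x ∂μ := by
  have hunion : ⋃ i ∈ (Finset.univ : Finset ι), g ⁻¹' {i} = Set.univ := by ext; simp
  have split := lintegral_biUnion_finset (μ := μ.restrict A) (s := Finset.univ)
    (t := fun i => g ⁻¹' {i}) (fun i _ j _ hij => Set.disjoint_left.2 fun x hi hj =>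
      hij (hi.symm.trans hj)) (fun i _ => hg i) F
  rw [hunion, Measure.restrict_univ] at split
  refine split.trans (Finset.sum_congr rfl fun i _ => ?_)
  rw [Measure.restrict_restrict (hg i), Set.inter_comm]

/-- The lower left corner of the quarter `b` of a square. -/
def quarterCorner (c : Plane) (ℓ : ℝ) (b : Fin 2 → Bool) : Plane :=
  WithLp.toLp 2 fun a => c a + if b a then ℓ / 2 else 0

/-- The quarter of a square that contains a given point of it. -/
def quarterIndex (c : Plane) (ℓ : ℝ) (z : Plane) : Fin 2 → Bool :=
  fun a => decide (c a + ℓ / 2 ≤ z a)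

theorem mem_square_quarter {c : Plane} {ℓ : ℝ} (hℓ : 0 < ℓ) (b : Fin 2 → Bool) (z : Plane) :
    z ∈ square (quarterCorner c ℓ b) (ℓ / 2) ↔ z ∈ square c ℓ ∧ quarterIndex c ℓ z = b := by
  simp only [square, Set.mem_ofPred_eq, quarterIndex, funext_iff, ← forall_and]
  refine forall_congr' fun a => ?_
  cases hb : b a <;> simp [quarterCorner, hb] <;> grind

theorem square_dyadic_induction {P : Plane → ℝ → Prop} {ε : ℝ} (hε : 0 < ε)
    (small : ∀ c ℓ, ℓ ≤ ε → P c ℓ)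
    (step : ∀ c ℓ, 0 < ℓ → (∀ b, P (quarterCorner c ℓ b) (ℓ / 2)) → P c ℓ) {ℓ : ℝ} (hℓ : 0 < ℓ)
    (c : Plane) : P c ℓ := by
  obtain ⟨m, hm⟩ := pow_unbounded_of_one_lt (ℓ / ε) one_lt_two
  rw [div_lt_iff₀' hε] at hm
  induction m generalizing c ℓ with
  | zero => exact small c ℓ (by simpa using hm.le)
  | succ m ih => exact step c ℓ hℓ fun b => ih (half_pos hℓ) _ (by rw [pow_succ] at hm; linarith)

theorem ofReal_sq_eq_four_mul (ℓ : ℝ) :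
    ENNReal.ofReal ℓ ^ 2 = 4 * ENNReal.ofReal (ℓ / 2) ^ 2 := by
  have htwice : ENNReal.ofReal ℓ = 2 * ENNReal.ofReal (ℓ / 2) := by
    rw [← ENNReal.ofReal_ofNat 2, ← ENNReal.ofReal_mul zero_le_two, mul_div_cancel₀ _ two_ne_zero]
  rw [htwice]
  ring

@[fun_prop]
theorem measurable_quarterIndex (c : Plane) (ℓ : ℝ) : Measurable (quarterIndex c ℓ) := by
  refine measurable_pi_iff.2 fun a => measurable_to_bool ?_
  simpa [quarterIndex, Set.preimage] using
    measurableSet_le measurable_const (by fun_prop : Measurable fun z : Plane => z a)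

/-- The assignment of quarters to the particles. -/
def quarterIndices (c : Plane) (ℓ : ℝ) (x : Config N) : Fin N → Fin 2 → Bool :=
  fun j => quarterIndex c ℓ (x j)

theorem measurableSet_quarterIndices (c : Plane) (ℓ : ℝ) (f : Fin N → Fin 2 → Bool) :
    MeasurableSet (quarterIndices c ℓ ⁻¹' {f}) :=
  (by unfold quarterIndices; fun_prop : Measurable (quarterIndices c ℓ)) (measurableSet_singleton f)

theorem IsSector.quarter {c : Plane} {ℓ : ℝ} (hℓ : 0 < ℓ) {S : Finset (Fin N)}
    {A : Set (Config N)} (hA : IsSector (square c ℓ) S A) (f : Fin N → Fin 2 → Bool)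
    (b : Fin 2 → Bool) :
    IsSector (square (quarterCorner c ℓ b) (ℓ / 2)) {j ∈ S | f j = b}
      (A ∩ quarterIndices c ℓ ⁻¹' {f}) where
  measurableSet := hA.measurableSet.inter (measurableSet_quarterIndices c ℓ f)
  mem_iff x hx j := by
    have hf : quarterIndex c ℓ (x j) = f j := congrFun hx.2 j
    rw [mem_square_quarter hℓ, hA.mem_iff x hx.1 j, hf, Finset.mem_filter]
  update_mem x hx j hj z hz := by
    rw [Finset.mem_filter] at hj
    rw [mem_square_quarter hℓ] at hz
    refine ⟨hA.update_mem x hx.1 j hj.1 z hz.1, funext fun l => ?_⟩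
    rw [quarterIndices]
    rcases eq_or_ne l j with rfl | hl
    · rw [Function.update_self, hz.2, hj.2]
    · rw [Function.update_of_ne hl]
      exact congrFun hx.2 l

theorem card_sub_one_le_card_mul_sum {ι κ : Type*} [Fintype κ] [DecidableEq κ] {S : Finset ι}
    (hS : Fintype.card κ < S.card) (f : ι → κ) :
    S.card - 1 ≤ Fintype.card κ * ∑ b, ({j ∈ S | f j = b}.card - 1) := by
  obtain ⟨j, -⟩ : S.Nonempty := Finset.card_pos.1 (by omega)
  have hκ : 1 ≤ Fintype.card κ := Fintype.card_pos_iff.2 ⟨f j⟩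
  have hsum : S.card ≤ ∑ b, ({j ∈ S | f j = b}.card - 1) + Fintype.card κ :=
    calc S.card = ∑ b, {j ∈ S | f j = b}.card :=
          Finset.card_eq_sum_card_fiberwise fun _ _ => Finset.mem_coe.2 (Finset.mem_univ _)
      _ ≤ ∑ b, (({j ∈ S | f j = b}.card - 1) + 1) := Finset.sum_le_sum fun b _ => by omega
      _ = _ := by simp [Finset.sum_add_distrib]
  rw [Nat.sub_le_iff_le_add]
  nlinarith

theorem mul_setLIntegral_le_of_quarters {F : Config N → ℝ≥0∞} {G : Fin N → Config N → ℝ≥0∞}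
    {c : Plane} {ℓ : ℝ} {S : Finset (Fin N)} (hS : 4 < S.card) {A : Set (Config N)}
    {a M : ℝ≥0∞} (h : ∀ (f : Fin N → Fin 2 → Bool) (b : Fin 2 → Bool),
      a * ((({j ∈ S | f j = b}.card - 1 : ℕ) : ℝ≥0∞) *
        ∫⁻ x in A ∩ quarterIndices c ℓ ⁻¹' {f}, F x) ≤
      M * (ENNReal.ofReal (ℓ / 2) ^ 2 * ∑ j ∈ S with f j = b,
        ∫⁻ x in A ∩ quarterIndices c ℓ ⁻¹' {f}, G j x)) :
    a * (((S.card - 1 : ℕ) : ℝ≥0∞) * ∫⁻ x in A, F x) ≤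
      M * (ENNReal.ofReal ℓ ^ 2 * ∑ j ∈ S, ∫⁻ x in A, G j x) := by
  simp only [fun F => setLIntegral_eq_sum_fibres (μ := volume)
    (measurableSet_quarterIndices c ℓ) A (F : Config N → ℝ≥0∞)]
  rw [Finset.sum_comm, Finset.mul_sum, Finset.mul_sum, Finset.mul_sum, Finset.mul_sum]
  refine Finset.sum_le_sum fun f _ => ?_
  set P := ∫⁻ x in A ∩ quarterIndices c ℓ ⁻¹' {f}, F x
  set T : Fin N → ℝ≥0∞ := fun j => ∫⁻ x in A ∩ quarterIndices c ℓ ⁻¹' {f}, G j x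
  have hcard : ((S.card - 1 : ℕ) : ℝ≥0∞) ≤
      4 * ∑ b, (({j ∈ S | f j = b}.card - 1 : ℕ) : ℝ≥0∞) := by
    exact_mod_cast (card_sub_one_le_card_mul_sum (by simpa using hS) f).trans_eq (by simp)
  calc _ ≤ a * ((4 * ∑ b, (({j ∈ S | f j = b}.card - 1 : ℕ) : ℝ≥0∞)) * P) := by gcongr
    _ = 4 * ∑ b, a * ((({j ∈ S | f j = b}.card - 1 : ℕ) : ℝ≥0∞) * P) := by
        rw [← Finset.mul_sum, ← Finset.sum_mul]; ring
    _ ≤ 4 * ∑ b, M * (ENNReal.ofReal (ℓ / 2) ^ 2 * ∑ j ∈ S with f j = b, T j) :=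
        mul_le_mul_right (Finset.sum_le_sum fun b _ => h f b) _
    _ = _ := by
        rw [← Finset.mul_sum, ← Finset.mul_sum, Finset.sum_fiberwise S f T,
          ofReal_sq_eq_four_mul ℓ]
        ring

theorem IsCore.fluxGap_mul_card_sub_one_mul_setLIntegral_le {η : Config N → ℂ} (hη : IsCore η)
    (α : ℝ) {c : Plane} {ℓ : ℝ} (hℓ : 0 < ℓ) {S : Finset (Fin N)} {A : Set (Config N)}
    (hA : IsSector (square c ℓ) S A) :
    ENNReal.ofReal (fluxGap α) * (((S.card - 1 : ℕ) : ℝ≥0∞) * ∫⁻ x in A, ‖η x‖ₑ ^ 2) ≤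
      6 * 256 ^ 4 * (ENNReal.ofReal ℓ ^ 2 * ∑ j ∈ S, ∫⁻ x in A, ‖momentum α j η x‖ₑ ^ 2) := by
  obtain ⟨ε, hε, hsep⟩ := hη.exists_separation
  refine square_dyadic_induction (P := fun c ℓ => ∀ (S : Finset (Fin N)) (A : Set (Config N)),
    IsSector (square c ℓ) S A → ENNReal.ofReal (fluxGap α) * (((S.card - 1 : ℕ) : ℝ≥0∞) *
      ∫⁻ x in A, ‖η x‖ₑ ^ 2) ≤ 6 * 256 ^ 4 * (ENNReal.ofReal ℓ ^ 2 *
        ∑ j ∈ S, ∫⁻ x in A, ‖momentum α j η x‖ₑ ^ 2)) hε ?_ ?_ hℓ c S A hA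
  · intro c ℓ hℓ S A hA
    rcases le_or_gt S.card 1 with hS | hS
    · simp [Nat.sub_eq_zero_of_le hS]
    simp [hA.setLIntegral_enorm_sq_eq_zero hS fun x hx j k hjk => hsep x hx j k hjk c ℓ hℓ]
  · intro c ℓ hℓ ih S A hA
    rcases le_or_gt S.card 1 with hS | hS
    · simp [Nat.sub_eq_zero_of_le hS]
    rcases le_or_gt S.card 4 with hS4 | hS4
    · have hcard : ((S.card - 1 : ℕ) : ℝ≥0∞) ≤ 3 := by
        exact_mod_cast (by omega : S.card - 1 ≤ 3)
      have few := hη.fluxGap_mul_setLIntegral_le_of_card_le_four α hℓ.le hA hS hS4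
      set T := ∑ j ∈ S, ∫⁻ x in A, ‖momentum α j η x‖ₑ ^ 2
      calc _ ≤ ENNReal.ofReal (fluxGap α) * (3 * ∫⁻ x in A, ‖η x‖ₑ ^ 2) := by gcongr
        _ = 3 * (ENNReal.ofReal (fluxGap α) * ∫⁻ x in A, ‖η x‖ₑ ^ 2) := by ring
        _ ≤ 3 * (2 * 256 ^ 4 * (ENNReal.ofReal ℓ ^ 2 * T)) := by gcongr
        _ = _ := by ring
    · exact mul_setLIntegral_le_of_quarters hS4 fun f b => ih b _ _ (hA.quarter hℓ f b)

end DyadicSubdivision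

section Region

variable {N : ℕ}

/-- The integral of the one-body functions `F j` over the configurations with particle `j` in `Q`,
summed over `j`: the expected number of particles in `Q` for `F j = |Ψ|²`, and their expected
kinetic energy for `F j = |D_j Ψ|²`. -/
def regionIntegral (F : Fin N → Config N → ℝ≥0∞) (Q : Set Plane) : ℝ≥0∞ :=
  ∑ j, ∫⁻ x in {x : Config N | x j ∈ Q}, F j x

theorem regionIntegral_le (F : Fin N → Config N → ℝ≥0∞) (Q : Set Plane) :
    regionIntegral F Q ≤ ∑ j, ∫⁻ x, F j x :=
  Finset.sum_le_sum fun _ _ => setLIntegral_le_lintegral _ _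

open Classical in
/-- The particles inside a region. -/
def particlesIn (Q : Set Plane) (x : Config N) : Finset (Fin N) := {j | x j ∈ Q}

theorem mem_particlesIn {Q : Set Plane} {x : Config N} {j : Fin N} :
    j ∈ particlesIn Q x ↔ x j ∈ Q := by
  simp [particlesIn]

theorem mem_preimage_particlesIn {Q : Set Plane} {S : Finset (Fin N)} {x : Config N} :
    x ∈ particlesIn Q ⁻¹' {S} ↔ ∀ j, x j ∈ Q ↔ j ∈ S := by
  simp only [Set.mem_preimage, Set.mem_singleton_iff, Finset.ext_iff, mem_particlesIn]

theorem isSector_particlesIn {Q : Set Plane} (hQ : MeasurableSet Q) (S : Finset (Fin N)) :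
    IsSector Q S (particlesIn Q ⁻¹' {S}) where
  measurableSet := by
    have hset : particlesIn Q ⁻¹' {S} = ⋂ j, {x : Config N | x j ∈ Q ↔ j ∈ S} := by
      ext x
      simp only [mem_preimage_particlesIn, Set.mem_iInter, Set.mem_ofPred_eq]
    rw [hset]
    exact MeasurableSet.iInter fun j =>
      (hQ.preimage (measurable_pi_apply j) : MeasurableSet {x : Config N | x j ∈ Q}).iff
        (MeasurableSet.const (j ∈ S))
  mem_iff _ hx := mem_preimage_particlesIn.1 hx
  update_mem x hx j hj z hz := by
    refine mem_preimage_particlesIn.2 fun l => ?_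
    rcases eq_or_ne l j with rfl | hl
    · simp [hz, hj]
    · rw [Function.update_of_ne hl, mem_preimage_particlesIn.1 hx l]

theorem lintegral_eq_sum_particlesIn {Q : Set Plane} (hQ : MeasurableSet Q)
    (f : Config N → ℝ≥0∞) : ∫⁻ x, f x = ∑ S, ∫⁻ x in particlesIn Q ⁻¹' {S}, f x := by
  rw [← setLIntegral_univ, setLIntegral_eq_sum_fibres
    fun S => (isSector_particlesIn hQ S).measurableSet]
  simp only [Set.univ_inter]

theorem regionIntegral_eq_sum {Q : Set Plane} (hQ : MeasurableSet Q)
    (F : Fin N → Config N → ℝ≥0∞) :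
    regionIntegral F Q = ∑ S, ∑ j ∈ S, ∫⁻ x in particlesIn Q ⁻¹' {S}, F j x := by
  have sector : ∀ j (S : Finset (Fin N)),
      ∫⁻ x in {x : Config N | x j ∈ Q} ∩ particlesIn Q ⁻¹' {S}, F j x =
        if j ∈ S then ∫⁻ x in particlesIn Q ⁻¹' {S}, F j x else 0 := fun j S => by
    have hiff : ∀ x ∈ particlesIn Q ⁻¹' {S}, x j ∈ Q ↔ j ∈ S := fun x hx =>
      mem_preimage_particlesIn.1 hx j
    split_ifs with hj
    · congr 2
      exact Set.inter_eq_right.2 fun x hx => (hiff x hx).2 hj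
    · have hempty : {x : Config N | x j ∈ Q} ∩ particlesIn Q ⁻¹' {S} = ∅ :=
        Set.eq_empty_of_forall_notMem fun x hx => hj ((hiff x hx.2).1 hx.1)
      rw [hempty, setLIntegral_empty]
  have split : ∀ j, ∫⁻ x in {x : Config N | x j ∈ Q}, F j x =
      ∑ S, ∫⁻ x in {x : Config N | x j ∈ Q} ∩ particlesIn Q ⁻¹' {S}, F j x := fun j =>
    setLIntegral_eq_sum_fibres (fun S => (isSector_particlesIn hQ S).measurableSet) _ _
  simp only [regionIntegral, split, sector]
  rw [Finset.sum_comm]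
  simp only [Finset.sum_ite_mem, Finset.univ_inter]

theorem IsCore.fluxGap_mul_regionIntegral_le {η : Config N → ℂ} (hη : IsCore η) (α : ℝ)
    (c : Plane) {ℓ : ℝ} (hℓ : 0 < ℓ) :
    ENNReal.ofReal (fluxGap α) * regionIntegral (fun _ x => ‖η x‖ₑ ^ 2) (square c ℓ) ≤
      ENNReal.ofReal (fluxGap α) * (∫⁻ x, ‖η x‖ₑ ^ 2) + 6 * 256 ^ 4 * (ENNReal.ofReal ℓ ^ 2 *
        regionIntegral (fun j x => ‖momentum α j η x‖ₑ ^ 2) (square c ℓ)) := by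
  have hQ := measurableSet_square c ℓ
  simp only [regionIntegral_eq_sum hQ, lintegral_eq_sum_particlesIn hQ, Finset.mul_sum (s := .univ),
    ← Finset.sum_add_distrib]
  refine Finset.sum_le_sum fun S _ => ?_
  have hcard : (S.card : ℝ≥0∞) ≤ 1 + ((S.card - 1 : ℕ) : ℝ≥0∞) := by
    exact_mod_cast (by omega : S.card ≤ 1 + (S.card - 1))
  rw [Finset.sum_const, nsmul_eq_mul]
  set P := ∫⁻ x in particlesIn (square c ℓ) ⁻¹' {S}, ‖η x‖ₑ ^ 2
  calc _ ≤ ENNReal.ofReal (fluxGap α) * ((1 + ((S.card - 1 : ℕ) : ℝ≥0∞)) * P) := by gcongr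
    _ = ENNReal.ofReal (fluxGap α) * P +
        ENNReal.ofReal (fluxGap α) * (((S.card - 1 : ℕ) : ℝ≥0∞) * P) := by ring
    _ ≤ _ := add_le_add_right (hη.fluxGap_mul_card_sub_one_mul_setLIntegral_le α hℓ
        (isSector_particlesIn hQ S)) _

theorem regionIntegral_le_of_separated {η : Config N → ℂ} {Q : Set Plane}
    (hQ : MeasurableSet Q) (hsep : ∀ x, η x ≠ 0 → ∀ j k, j ≠ k → x j ∈ Q → x k ∉ Q) :
    regionIntegral (fun _ x => ‖η x‖ₑ ^ 2) Q ≤ ∫⁻ x, ‖η x‖ₑ ^ 2 := by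
  rw [regionIntegral_eq_sum hQ, lintegral_eq_sum_particlesIn hQ]
  refine Finset.sum_le_sum fun S _ => ?_
  rw [Finset.sum_const, nsmul_eq_mul]
  rcases le_or_gt S.card 1 with hS | hS
  · exact mul_le_of_le_one_left zero_le (by exact_mod_cast hS)
  · simp [(isSector_particlesIn hQ S).setLIntegral_enorm_sq_eq_zero hS hsep]

theorem sq_sum_lintegral_mul_le {X ι : Type*} [MeasurableSpace X] (s : Finset ι)
    {μ : ι → Measure X} {f g : ι → X → ℝ≥0∞} (hf : ∀ i ∈ s, AEMeasurable (f i) (μ i))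
    (hg : ∀ i ∈ s, AEMeasurable (g i) (μ i)) :
    (∑ i ∈ s, ∫⁻ x, f i x * g i x ∂μ i) ^ 2 ≤
      (∑ i ∈ s, ∫⁻ x, f i x ^ 2 ∂μ i) * ∑ i ∈ s, ∫⁻ x, g i x ^ 2 ∂μ i := by
  have sqrt_sq : ∀ p : ℝ≥0∞, (p ^ (1 / 2 : ℝ)) ^ (2 : ℕ) = p := fun p => by
    rw [← ENNReal.rpow_mul_natCast]; norm_num
  have hölder : ∑ i ∈ s, ∫⁻ x, f i x * g i x ∂μ i ≤ ∑ i ∈ s,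
      (∫⁻ x, f i x ^ 2 ∂μ i) ^ (1 / 2 : ℝ) * (∫⁻ x, g i x ^ 2 ∂μ i) ^ (1 / 2 : ℝ) :=
    Finset.sum_le_sum fun i hi => by
      simpa using ENNReal.lintegral_mul_le_Lp_mul_Lq (μ i) .two_two (hf i hi) (hg i hi)
  have cauchy := ENNReal.inner_le_Lp_mul_Lq s (fun i => (∫⁻ x, f i x ^ 2 ∂μ i) ^ (1 / 2 : ℝ))
    (fun i => (∫⁻ x, g i x ^ 2 ∂μ i) ^ (1 / 2 : ℝ)) .two_two
  simp only [ENNReal.rpow_ofNat, sqrt_sq] at cauchy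
  calc _ ≤ _ := pow_le_pow_left₀ zero_le (hölder.trans cauchy) 2
    _ = _ := by rw [mul_pow, sqrt_sq, sqrt_sq]

end Region

section Ladyzhenskaya

@[fun_prop]
theorem measurable_slicePoint (a : Fin 2) :
    Measurable fun p : ℝ × ℝ => slicePoint a p.1 p.2 := by
  unfold slicePoint
  split_ifs <;> fun_prop

theorem slicePoint_mem_square_iff {c : Plane} {ℓ s t : ℝ} {a b : Fin 2} (hab : b ≠ a) :
    slicePoint a s t ∈ square c ℓ ↔
      t ∈ Set.Ico (c b) (c b + ℓ) ∧ s ∈ Set.Ico (c a) (c a + ℓ) := by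
  have hor : ∀ i, i = a ∨ i = b := by omega
  refine ⟨fun h => ⟨by simpa only [slicePoint_of_ne hab] using h b, by simpa using h a⟩,
    fun h i => ?_⟩
  rcases hor i with rfl | rfl
  · simpa using h.2
  · simpa only [slicePoint_of_ne hab] using h.1

theorem setLIntegral_square {f : Plane → ℝ≥0∞} (hf : Measurable f) (c : Plane) (ℓ : ℝ)
    {a b : Fin 2} (hab : b ≠ a) :
    ∫⁻ z in square c ℓ, f z = ∫⁻ t in Set.Ico (c b) (c b + ℓ),
      ∫⁻ s in Set.Ico (c a) (c a + ℓ), f (slicePoint a s t) := by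
  have hQ := measurableSet_square c ℓ
  simp only [← lintegral_indicator hQ, lintegral_slicePoint (hf.indicator hQ) a,
    ← lintegral_indicator measurableSet_Ico]
  refine lintegral_congr fun t => ?_
  by_cases ht : t ∈ Set.Ico (c b) (c b + ℓ)
  · classical
    simp only [ht, Set.indicator_of_mem, Set.indicator_apply, slicePoint_mem_square_iff hab,
      true_and]
  · simp only [ht, Set.indicator_of_notMem, not_false_eq_true, slicePoint_mem_square_iff hab,
      false_and, lintegral_zero]

theorem slicePoint_one_eq (s t : ℝ) : slicePoint 1 s t = slicePoint 0 t s := by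
  simp [slicePoint]

/- On the square, `u² ≤ B₀(t) B₁(s)`, where `Bₐ` is the integral of `H` over the line in direction
`a`; the right-hand side is a product of functions of one variable each. -/
theorem setLIntegral_square_sq_le_of_line_integrals {u H : Plane → ℝ≥0∞} (hu : Measurable u)
    (hH : Measurable H) (c : Plane) (ℓ : ℝ)
    (h : ∀ (a : Fin 2) (s t : ℝ), s ∈ Set.Ico (c a) (c a + ℓ) →
      u (slicePoint a s t) ≤ ∫⁻ τ in Set.Ico (c a) (c a + ℓ), H (slicePoint a τ t)) :
    ∫⁻ z in square c ℓ, u z ^ 2 ≤ (∫⁻ z in square c ℓ, H z) ^ 2 := by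
  have h10 : (1 : Fin 2) ≠ 0 := by decide
  set I : Fin 2 → Set ℝ := fun a => Set.Ico (c a) (c a + ℓ)
  set B : Fin 2 → ℝ → ℝ≥0∞ := fun a t => ∫⁻ τ in I a, H (slicePoint a τ t)
  have hB : ∀ a, Measurable (B a) := fun a =>
    (by fun_prop : Measurable fun p : ℝ × ℝ => H (slicePoint a p.2 p.1)).lintegral_prod_right'
  calc _ = ∫⁻ t in I 1, ∫⁻ s in I 0, u (slicePoint 0 s t) ^ 2 :=
        setLIntegral_square (hu.pow_const 2) c ℓ h10
    _ ≤ ∫⁻ t in I 1, ∫⁻ s in I 0, B 0 t * B 1 s := by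
        refine setLIntegral_mono' measurableSet_Ico fun t ht =>
          setLIntegral_mono' measurableSet_Ico fun s hs => ?_
        rw [sq]
        refine mul_le_mul' (h 0 s t hs) ?_
        rw [← slicePoint_one_eq]
        exact h 1 t s ht
    _ = (∫⁻ t in I 1, B 0 t) * ∫⁻ s in I 0, B 1 s := by
        rw [← lintegral_mul_const _ (hB 0)]
        exact lintegral_congr fun t => lintegral_const_mul _ (hB 1)
    _ = _ := by
        rw [← setLIntegral_square hH c ℓ h10, ← setLIntegral_square hH c ℓ h10.symm, sq]

end Ladyzhenskaya

section LocalUncertainty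

variable {n : ℕ}

theorem measurePreserving_insertNth (j : Fin (n + 1)) :
    MeasurePreserving fun p : Plane × Config n => (Fin.insertNth j p.1 p.2 : Config (n + 1)) :=
  (volume_preserving_piFinSuccAbove (fun _ : Fin (n + 1) => Plane) j).symm

theorem lintegral_insertNth (j : Fin (n + 1)) {F : Config (n + 1) → ℝ≥0∞} (hF : AEMeasurable F) :
    ∫⁻ x, F x = ∫⁻ z : Plane, ∫⁻ y : Config n, F (Fin.insertNth j z y) := by
  have hpres := measurePreserving_insertNth (n := n) j
  rw [← hpres.map_eq] at hF
  rw [← hpres.map_eq, lintegral_map' hF hpres.aemeasurable, Measure.volume_eq_prod,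
    lintegral_prod (fun p => F (Fin.insertNth j p.1 p.2)) (hF.comp_aemeasurable hpres.aemeasurable)]

theorem setLIntegral_insertNth (j : Fin (n + 1)) {F : Config (n + 1) → ℝ≥0∞} (hF : Measurable F)
    {Q : Set Plane} (hQ : MeasurableSet Q) :
    ∫⁻ x in {x : Config (n + 1) | x j ∈ Q}, F x =
      ∫⁻ z in Q, ∫⁻ y : Config n, F (Fin.insertNth j z y) := by
  have hm : MeasurableSet {x : Config (n + 1) | x j ∈ Q} := hQ.preimage (measurable_pi_apply j)
  rw [← lintegral_indicator hm, lintegral_insertNth j (hF.indicator hm).aemeasurable,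
    ← lintegral_indicator hQ]
  refine lintegral_congr fun z => ?_
  by_cases hz : z ∈ Q <;> simp [hz]

/-- The marginal of the one-body functions `F j` in the position of particle `j`, summed over `j`;
for `F j = |Ψ|²` with symmetric `Ψ` this is the one-body density. -/
def oneBodyMarginal (F : Fin (n + 1) → Config (n + 1) → ℝ≥0∞) (z : Plane) : ℝ≥0∞ :=
  ∑ j, ∫⁻ y : Config n, F j (Fin.insertNth j z y)

section

variable {F : Fin (n + 1) → Config (n + 1) → ℝ≥0∞}

theorem measurable_lintegral_insertNth (hF : ∀ j, Measurable (F j)) (j : Fin (n + 1)) :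
    Measurable fun z => ∫⁻ y : Config n, F j (Fin.insertNth j z y) :=
  ((hF j).comp (measurePreserving_insertNth j).measurable).lintegral_prod_right'

theorem measurable_oneBodyMarginal (hF : ∀ j, Measurable (F j)) :
    Measurable (oneBodyMarginal F) :=
  Finset.measurable_sum _ fun j _ => measurable_lintegral_insertNth hF j

theorem measurable_density {Ψ : Config (n + 1) → ℂ} (hΨ : Measurable Ψ) :
    Measurable (density Ψ) := by
  have hslice := measurable_lintegral_insertNth (fun _ => hΨ.enorm.pow_const 2) (0 : Fin (n + 1))
  simp only [Fin.insertNth_zero'] at hslice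
  exact hslice.const_mul _

theorem setLIntegral_oneBodyMarginal (hF : ∀ j, Measurable (F j)) {Q : Set Plane}
    (hQ : MeasurableSet Q) : ∫⁻ z in Q, oneBodyMarginal F z = regionIntegral F Q := by
  simp only [oneBodyMarginal, regionIntegral,
    lintegral_finsetSum _ fun j _ => measurable_lintegral_insertNth hF j]
  exact Finset.sum_congr rfl fun j _ => (setLIntegral_insertNth j (hF j) hQ).symm

theorem setLIntegral_slicePoint_oneBodyMarginal (hF : ∀ j, Measurable (F j)) (a : Fin 2) (t : ℝ)
    (I : Set ℝ) : ∫⁻ τ in I, oneBodyMarginal F (slicePoint a τ t) =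
      ∑ j, ∫⁻ y : Config n, ∫⁻ τ in I, F j (Fin.insertNth j (slicePoint a τ t) y) := by
  have hslice : Measurable fun τ : ℝ => slicePoint a τ t := by fun_prop
  simp only [oneBodyMarginal]
  rw [lintegral_finsetSum (f := fun j τ => ∫⁻ y : Config n, F j (Fin.insertNth j (slicePoint a τ t)
    y)) _ fun j _ => (measurable_lintegral_insertNth hF j).comp hslice]
  refine Finset.sum_congr rfl fun j _ => lintegral_lintegral_swap ?_
  exact ((hF j).comp ((measurePreserving_insertNth j).measurable.comp
    (hslice.prodMap measurable_id))).aemeasurable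

end

theorem IsCore.apply_insertNth {η : Config (n + 1) → ℂ} (hη : IsCore η) (j : Fin (n + 1))
    (z : Plane) (y : Config n) :
    η (Fin.insertNth j z y) = η (Fin.cons z y : Config (n + 1)) := by
  rw [← Fin.cons_comp_cycleRange]
  exact hη.symmetric _ _

theorem IsCore.density_eq_oneBodyMarginal {η : Config (n + 1) → ℂ} (hη : IsCore η) :
    density η = oneBodyMarginal fun _ x => ‖η x‖ₑ ^ 2 := by
  funext z
  simp only [density, oneBodyMarginal, hη.apply_insertNth, Finset.sum_const, Finset.card_univ,
    Fintype.card_fin, nsmul_eq_mul]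

variable {η : Config (n + 1) → ℂ}

theorem IsCore.ofReal_mul_enorm_sq_insertNth_le (hη : IsCore η) (α : ℝ) (j : Fin (n + 1))
    (y : Config n) (a : Fin 2) {c ℓ s : ℝ} (t : ℝ) (hs : s ∈ Set.Ico c (c + ℓ)) :
    ENNReal.ofReal ℓ * ‖η (Fin.insertNth j (slicePoint a s t) y)‖ₑ ^ 2 ≤
      ∫⁻ τ in Set.Ico c (c + ℓ), (‖η (Fin.insertNth j (slicePoint a τ t) y)‖ₑ ^ 2 +
        ENNReal.ofReal ℓ * (2 * (‖η (Fin.insertNth j (slicePoint a τ t) y)‖ₑ *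
          ‖momentum α j η (Fin.insertNth j (slicePoint a τ t) y)‖ₑ))) := by
  set γ : ℝ → Config (n + 1) := fun τ => Fin.insertNth j (slicePoint a τ t) y
  have hγ : ∀ τ, Function.update (γ 0) j (slicePoint a τ t) = γ τ := fun τ => by simp [γ]
  have hγm : Measurable γ :=
    (measurePreserving_insertNth j).measurable.comp (by fun_prop :
      Measurable fun τ : ℝ => (slicePoint a τ t, y))
  set I := Set.Ico c (c + ℓ)
  have hvol : volume I = ENNReal.ofReal ℓ := by simp [I]
  have transport : ∀ τ ∈ I, ‖η (γ s)‖ₑ ^ 2 ≤ ‖η (γ τ)‖ₑ ^ 2 +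
      ∫⁻ σ in I, 2 * (‖η (γ σ)‖ₑ * ‖momentum α j η (γ σ)‖ₑ) := fun τ hτ => by
    have bound := enorm_sq_le_add_lintegral_slice hη.contDiff_one α j a (γ 0) t τ s
    simp only [hγ] at bound
    exact bound.trans (add_le_add_right (lintegral_mono_set
      (Set.uIoc_subset_uIcc.trans (Set.ordConnected_Ico.uIcc_subset hτ hs))) _)
  calc ENNReal.ofReal ℓ * ‖η (γ s)‖ₑ ^ 2 = ∫⁻ _ in I, ‖η (γ s)‖ₑ ^ 2 := by
        rw [setLIntegral_const, hvol, mul_comm]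
    _ ≤ ∫⁻ τ in I, (‖η (γ τ)‖ₑ ^ 2 +
          ∫⁻ σ in I, 2 * (‖η (γ σ)‖ₑ * ‖momentum α j η (γ σ)‖ₑ)) :=
        setLIntegral_mono' measurableSet_Ico transport
    _ = _ := by
        have hηγ : Measurable fun τ => ‖η (γ τ)‖ₑ ^ 2 :=
          (hη.smooth.continuous.measurable.comp hγm).enorm.pow_const 2
        rw [lintegral_add_left hηγ, lintegral_add_left hηγ, setLIntegral_const, hvol, mul_comm,
          lintegral_const_mul' _ _ ENNReal.ofReal_ne_top]

theorem IsCore.sq_mul_setLIntegral_density_sq_le_sq (hη : IsCore η) (α : ℝ) (c : Plane) (ℓ : ℝ) :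
    ENNReal.ofReal ℓ ^ 2 * ∫⁻ z in square c ℓ, density η z ^ 2 ≤
      regionIntegral (fun j x => ‖η x‖ₑ ^ 2 +
        ENNReal.ofReal ℓ * (2 * (‖η x‖ₑ * ‖momentum α j η x‖ₑ))) (square c ℓ) ^ 2 := by
  have hηm := hη.smooth.continuous.measurable
  set F : Fin (n + 1) → Config (n + 1) → ℝ≥0∞ := fun j x => ‖η x‖ₑ ^ 2 +
    ENNReal.ofReal ℓ * (2 * (‖η x‖ₑ * ‖momentum α j η x‖ₑ))
  have hF : ∀ j, Measurable (F j) := fun j => by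
    have := measurable_momentum hη.contDiff_one α j
    fun_prop
  rw [← lintegral_const_mul' _ _ (by finiteness), ← setLIntegral_oneBodyMarginal hF
    (measurableSet_square c ℓ)]
  simp only [← mul_pow]
  refine setLIntegral_square_sq_le_of_line_integrals ((measurable_density hηm).const_mul _)
    (measurable_oneBodyMarginal hF) c ℓ fun a s t hs => ?_
  rw [setLIntegral_slicePoint_oneBodyMarginal hF, hη.density_eq_oneBodyMarginal, oneBodyMarginal,
    Finset.mul_sum]
  refine Finset.sum_le_sum fun j _ => ?_
  rw [← lintegral_const_mul' _ _ ENNReal.ofReal_ne_top]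
  exact lintegral_mono fun y => hη.ofReal_mul_enorm_sq_insertNth_le α j y a t hs

theorem add_sq_le_two_mul_sq_add (p q : ℝ≥0∞) : (p + q) ^ 2 ≤ 2 * p ^ 2 + 2 * q ^ 2 := by
  have young := two_mul_mul_le_young one_ne_zero ENNReal.one_ne_top p q
  calc (p + q) ^ 2 = p ^ 2 + q ^ 2 + 2 * (p * q) := by ring
    _ ≤ p ^ 2 + q ^ 2 + (1⁻¹ * p ^ 2 + 1 * q ^ 2) := by gcongr
    _ = _ := by rw [inv_one]; ring

theorem IsCore.sq_mul_setLIntegral_density_sq_le (hη : IsCore η) (α : ℝ) (c : Plane) (ℓ : ℝ) :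
    ENNReal.ofReal ℓ ^ 2 * ∫⁻ z in square c ℓ, density η z ^ 2 ≤
      2 * regionIntegral (fun _ x => ‖η x‖ₑ ^ 2) (square c ℓ) ^ 2 +
      8 * ENNReal.ofReal ℓ ^ 2 * (regionIntegral (fun _ x => ‖η x‖ₑ ^ 2) (square c ℓ) *
        regionIntegral (fun j x => ‖momentum α j η x‖ₑ ^ 2) (square c ℓ)) := by
  have hηm := hη.smooth.continuous.measurable
  have hDm := measurable_momentum hη.contDiff_one α
  refine (hη.sq_mul_setLIntegral_density_sq_le_sq α c ℓ).trans ?_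
  set L := ENNReal.ofReal ℓ
  set M := regionIntegral (fun _ x => ‖η x‖ₑ ^ 2) (square c ℓ) with hM
  set T := regionIntegral (fun j x => ‖momentum α j η x‖ₑ ^ 2) (square c ℓ)
  set X := regionIntegral (fun j x => ‖η x‖ₑ * ‖momentum α j η x‖ₑ) (square c ℓ) with hX
  have split : regionIntegral (fun j x => ‖η x‖ₑ ^ 2 +
      L * (2 * (‖η x‖ₑ * ‖momentum α j η x‖ₑ))) (square c ℓ) = M + 2 * L * X := by
    simp only [hM, hX, regionIntegral, Finset.mul_sum, ← Finset.sum_add_distrib]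
    refine Finset.sum_congr rfl fun j _ => ?_
    rw [lintegral_add_left (by fun_prop), lintegral_const_mul' _ _ (by finiteness),
      lintegral_const_mul' _ _ (by finiteness)]
    ring
  have cauchySchwarz : X ^ 2 ≤ M * T := sq_sum_lintegral_mul_le Finset.univ
    (fun _ _ => hηm.enorm.aemeasurable) fun j _ => (hDm j).enorm.aemeasurable
  rw [split]
  calc (M + 2 * L * X) ^ 2 ≤ 2 * M ^ 2 + 2 * (2 * L * X) ^ 2 := add_sq_le_two_mul_sq_add _ _
    _ = 2 * M ^ 2 + 8 * L ^ 2 * X ^ 2 := by ring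
    _ ≤ _ := by gcongr

end LocalUncertainty

section Quarters

variable {N : ℕ}

theorem setLIntegral_square_eq_sum_quarters {c : Plane} {ℓ : ℝ} (hℓ : 0 < ℓ)
    (f : Plane → ℝ≥0∞) :
    ∫⁻ z in square c ℓ, f z = ∑ b, ∫⁻ z in square (quarterCorner c ℓ b) (ℓ / 2), f z := by
  rw [setLIntegral_eq_sum_fibres fun b => measurable_quarterIndex c ℓ (measurableSet_singleton b)]
  refine Finset.sum_congr rfl fun b _ => ?_
  congr 2
  ext z
  exact (mem_square_quarter hℓ b z).symm

theorem regionIntegral_square_eq_sum_quarters {c : Plane} {ℓ : ℝ} (hℓ : 0 < ℓ)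
    (F : Fin N → Config N → ℝ≥0∞) :
    regionIntegral F (square c ℓ) =
      ∑ b, regionIntegral F (square (quarterCorner c ℓ b) (ℓ / 2)) := by
  simp only [regionIntegral]
  rw [Finset.sum_comm]
  refine Finset.sum_congr rfl fun j _ => ?_
  have hindex : Measurable fun x : Config N => quarterIndex c ℓ (x j) := by fun_prop
  rw [setLIntegral_eq_sum_fibres fun b => hindex (measurableSet_singleton b)]
  refine Finset.sum_congr rfl fun b _ => ?_
  congr 2
  ext x
  exact (mem_square_quarter hℓ b (x j)).symm

end Quarters

section LiebThirring

variable {n : ℕ} {η : Config (n + 1) → ℂ}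

theorem lintegral_enorm_sq_eq_eLpNorm_sq {X E : Type*} [MeasurableSpace X] [NormedAddCommGroup E]
    {μ : Measure X} (f : X → E) : ∫⁻ x, ‖f x‖ₑ ^ 2 ∂μ = eLpNorm f 2 μ ^ 2 := by
  simpa using (eLpNorm_nnreal_pow_eq_lintegral (f := f) (μ := μ) (p := 2) two_ne_zero).symm

theorem lintegral_enorm_sq_ne_top {X E : Type*} [MeasurableSpace X] [NormedAddCommGroup E]
    {μ : Measure X} {f : X → E} (hf : MemLp f 2 μ) : ∫⁻ x, ‖f x‖ₑ ^ 2 ∂μ ≠ ⊤ := by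
  rw [lintegral_enorm_sq_eq_eLpNorm_sq]
  exact ENNReal.pow_ne_top hf.eLpNorm_ne_top

theorem IsCore.lintegral_enorm_sq_ne_top {N : ℕ} {η : Config N → ℂ} (hη : IsCore η) :
    ∫⁻ x, ‖η x‖ₑ ^ 2 ≠ ⊤ :=
  Anyon.lintegral_enorm_sq_ne_top
    (hη.smooth.continuous.memLp_of_hasCompactSupport hη.compact)

theorem sum_add_le_sum_of_add_card_mul_le {ι : Type*} [Fintype ι] {r t : ι → ℝ≥0∞} {κ : ℝ≥0∞}
    (hκ : κ ≠ ⊤) (weak : ∀ b, r b ≤ κ + t b) {b₀ : ι}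
    (strong : r b₀ + Fintype.card ι * κ ≤ t b₀) : ∑ b, r b + κ ≤ ∑ b, t b := by
  classical
  set s := Finset.univ.erase b₀
  have hcard : (Fintype.card ι : ℝ≥0∞) = s.card + 1 := by
    rw [Finset.card_erase_of_mem (Finset.mem_univ b₀), Finset.card_univ]
    exact_mod_cast (Nat.sub_add_cancel (Fintype.card_pos_iff.2 ⟨b₀⟩)).symm
  have others : ∑ b ∈ s, r b ≤ s.card * κ + ∑ b ∈ s, t b := by
    refine (Finset.sum_le_sum fun b _ => weak b).trans_eq ?_
    rw [Finset.sum_add_distrib, Finset.sum_const, nsmul_eq_mul]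
  have hfin : (s.card : ℝ≥0∞) * κ ≠ ⊤ := by finiteness
  refine (ENNReal.add_le_add_iff_right hfin).1 ?_
  rw [← Finset.add_sum_erase _ r (Finset.mem_univ b₀),
    ← Finset.add_sum_erase _ t (Finset.mem_univ b₀)]
  calc r b₀ + ∑ b ∈ s, r b + κ + s.card * κ
      = r b₀ + Fintype.card ι * κ + ∑ b ∈ s, r b := by rw [hcard]; ring
    _ ≤ t b₀ + (s.card * κ + ∑ b ∈ s, t b) := add_le_add strong others
    _ = _ := by ring

theorem IsCore.sq_mul_setLIntegral_density_sq_le_of_regionIntegral_le (hη : IsCore η) (α : ℝ)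
    (c : Plane) (ℓ : ℝ)
    (few : regionIntegral (fun _ x => ‖η x‖ₑ ^ 2) (square c ℓ) ≤ 2 * ∫⁻ x, ‖η x‖ₑ ^ 2) :
    ENNReal.ofReal ℓ ^ 2 * ∫⁻ z in square c ℓ, density η z ^ 2 ≤
      8 * (∫⁻ x, ‖η x‖ₑ ^ 2) ^ 2 + 16 * (ENNReal.ofReal ℓ ^ 2 * ((∫⁻ x, ‖η x‖ₑ ^ 2) *
        regionIntegral (fun j x => ‖momentum α j η x‖ₑ ^ 2) (square c ℓ))) := by
  refine (hη.sq_mul_setLIntegral_density_sq_le α c ℓ).trans ?_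
  set m := ∫⁻ x, ‖η x‖ₑ ^ 2
  set T := regionIntegral (fun j x => ‖momentum α j η x‖ₑ ^ 2) (square c ℓ)
  calc _ ≤ 2 * (2 * m) ^ 2 + 8 * ENNReal.ofReal ℓ ^ 2 * ((2 * m) * T) := by gcongr
    _ = _ := by ring

theorem IsCore.fluxGap_mul_setLIntegral_density_sq_half_le (hη : IsCore η) (α : ℝ) (c : Plane)
    (ℓ : ℝ)
    (few : regionIntegral (fun _ x => ‖η x‖ₑ ^ 2) (square c (ℓ / 2)) ≤ 2 * ∫⁻ x, ‖η x‖ₑ ^ 2) :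
    ENNReal.ofReal (fluxGap α) *
        (ENNReal.ofReal ℓ ^ 2 * ∫⁻ z in square c (ℓ / 2), density η z ^ 2) ≤
      32 * (ENNReal.ofReal (fluxGap α) * (∫⁻ x, ‖η x‖ₑ ^ 2) ^ 2) +
        16 * (ENNReal.ofReal ℓ ^ 2 * ((∫⁻ x, ‖η x‖ₑ ^ 2) *
          regionIntegral (fun j x => ‖momentum α j η x‖ₑ ^ 2) (square c (ℓ / 2)))) := by
  have bound := hη.sq_mul_setLIntegral_density_sq_le_of_regionIntegral_le α c (ℓ / 2) few
  have ha : ENNReal.ofReal (fluxGap α) ≤ 1 := ENNReal.ofReal_le_one.2 (fluxGap_le_one α)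
  set m := ∫⁻ x, ‖η x‖ₑ ^ 2
  set a := ENNReal.ofReal (fluxGap α)
  set L := ENNReal.ofReal ℓ
  set R := ∫⁻ z in square c (ℓ / 2), density η z ^ 2
  set T := regionIntegral (fun j x => ‖momentum α j η x‖ₑ ^ 2) (square c (ℓ / 2))
  have hL2 : L ^ 2 = 4 * ENNReal.ofReal (ℓ / 2) ^ 2 := ofReal_sq_eq_four_mul ℓ
  calc a * (L ^ 2 * R) = 4 * (a * (ENNReal.ofReal (ℓ / 2) ^ 2 * R)) := by rw [hL2]; ring
    _ ≤ 4 * (a * (8 * m ^ 2 + 16 * (ENNReal.ofReal (ℓ / 2) ^ 2 * (m * T)))) := by gcongr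
    _ = 32 * (a * m ^ 2) + a * (16 * (L ^ 2 * (m * T))) := by rw [hL2]; ring
    _ ≤ 32 * (a * m ^ 2) + 1 * (16 * (L ^ 2 * (m * T))) := by gcongr
    _ = _ := by rw [one_mul]

/-- The local Lieb–Thirring inequality on the square with corner `c` and side `ℓ`. The additional
term `32 m²` on the left, where `m = ∫ |η|²`, makes the inequality stable under merging a square
where it holds with squares that contain few particles, where only an inequality with an error
`8 m²` on the right is available. -/
def LocalLiebThirring (α : ℝ) (η : Config (n + 1) → ℂ) (c : Plane) (ℓ : ℝ) : Prop :=
  ENNReal.ofReal (fluxGap α) * (ENNReal.ofReal ℓ ^ 2 * (∫⁻ z in square c ℓ, density η z ^ 2) +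
      32 * (∫⁻ x, ‖η x‖ₑ ^ 2) ^ 2) ≤
    (960 * 256 ^ 4 + 16) * (ENNReal.ofReal ℓ ^ 2 * ((∫⁻ x, ‖η x‖ₑ ^ 2) *
      regionIntegral (fun j x => ‖momentum α j η x‖ₑ ^ 2) (square c ℓ)))

theorem IsCore.localLiebThirring_of_quarter (hη : IsCore η) (α : ℝ) {c : Plane} {ℓ : ℝ}
    (hℓ : 0 < ℓ)
    (hquarter : ∀ b, 2 * ∫⁻ x, ‖η x‖ₑ ^ 2 < regionIntegral (fun _ x => ‖η x‖ₑ ^ 2)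
      (square (quarterCorner c ℓ b) (ℓ / 2)) → LocalLiebThirring α η (quarterCorner c ℓ b) (ℓ / 2))
    {b₀ : Fin 2 → Bool} (hb₀ : 2 * ∫⁻ x, ‖η x‖ₑ ^ 2 <
      regionIntegral (fun _ x => ‖η x‖ₑ ^ 2) (square (quarterCorner c ℓ b₀) (ℓ / 2))) :
    LocalLiebThirring α η c ℓ := by
  have hm := hη.lintegral_enorm_sq_ne_top
  unfold LocalLiebThirring at hquarter ⊢
  rw [setLIntegral_square_eq_sum_quarters hℓ, regionIntegral_square_eq_sum_quarters hℓ]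
  set m := ∫⁻ x, ‖η x‖ₑ ^ 2
  set a := ENNReal.ofReal (fluxGap α)
  set K : ℝ≥0∞ := 960 * 256 ^ 4 + 16
  set L := ENNReal.ofReal ℓ
  set R : (Fin 2 → Bool) → ℝ≥0∞ := fun b =>
    ∫⁻ z in square (quarterCorner c ℓ b) (ℓ / 2), density η z ^ 2
  set T : (Fin 2 → Bool) → ℝ≥0∞ := fun b => regionIntegral (fun j x => ‖momentum α j η x‖ₑ ^ 2)
    (square (quarterCorner c ℓ b) (ℓ / 2))
  have hL2 : L ^ 2 = 4 * ENNReal.ofReal (ℓ / 2) ^ 2 := ofReal_sq_eq_four_mul ℓ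
  have strong : ∀ b, 2 * m < regionIntegral (fun _ x => ‖η x‖ₑ ^ 2)
      (square (quarterCorner c ℓ b) (ℓ / 2)) →
      a * (L ^ 2 * R b) + 4 * (32 * (a * m ^ 2)) ≤ K * (L ^ 2 * (m * T b)) := fun b hb => by
    calc _ = 4 * (a * (ENNReal.ofReal (ℓ / 2) ^ 2 * R b + 32 * m ^ 2)) := by rw [hL2]; ring
      _ ≤ 4 * (K * (ENNReal.ofReal (ℓ / 2) ^ 2 * (m * T b))) := mul_le_mul_right (hquarter b hb) 4
      _ = _ := by rw [hL2]; ring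
  have weak : ∀ b, a * (L ^ 2 * R b) ≤ 32 * (a * m ^ 2) + K * (L ^ 2 * (m * T b)) := fun b => by
    rcases lt_or_ge (2 * m) (regionIntegral (fun _ x => ‖η x‖ₑ ^ 2)
      (square (quarterCorner c ℓ b) (ℓ / 2))) with many | few
    · exact (le_self_add.trans (strong b many)).trans le_add_self
    · refine (hη.fluxGap_mul_setLIntegral_density_sq_half_le α _ ℓ few).trans ?_
      gcongr
      exact le_add_self
  have merged := sum_add_le_sum_of_add_card_mul_le (by finiteness) weak (b₀ := b₀)
    (by simpa using strong b₀ hb₀)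
  calc _ = ∑ b, a * (L ^ 2 * R b) + 32 * (a * m ^ 2) := by
        rw [← Finset.mul_sum, ← Finset.mul_sum]; ring
    _ ≤ ∑ b, K * (L ^ 2 * (m * T b)) := merged
    _ = _ := by simp only [Finset.mul_sum]

theorem IsCore.fluxGap_mul_lintegral_enorm_sq_le (hη : IsCore η) (α : ℝ) {c : Plane} {ℓ : ℝ}
    (hℓ : 0 < ℓ)
    (many : 2 * ∫⁻ x, ‖η x‖ₑ ^ 2 < regionIntegral (fun _ x => ‖η x‖ₑ ^ 2) (square c ℓ)) :
    ENNReal.ofReal (fluxGap α) * ∫⁻ x, ‖η x‖ₑ ^ 2 ≤ 6 * 256 ^ 4 * (ENNReal.ofReal ℓ ^ 2 *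
      regionIntegral (fun j x => ‖momentum α j η x‖ₑ ^ 2) (square c ℓ)) := by
  have hm := hη.lintegral_enorm_sq_ne_top
  have exclusion := hη.fluxGap_mul_regionIntegral_le α c hℓ
  set m := ∫⁻ x, ‖η x‖ₑ ^ 2
  set a := ENNReal.ofReal (fluxGap α)
  have ham : a * m ≠ ⊤ := by finiteness
  refine (ENNReal.add_le_add_iff_left ham).1 (le_trans ?_ exclusion)
  calc a * m + a * m = a * (2 * m) := by ring
    _ ≤ _ := by gcongr

theorem IsCore.localLiebThirring_of_forall_quarter_le (hη : IsCore η) (α : ℝ) {c : Plane} {ℓ : ℝ}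
    (hℓ : 0 < ℓ)
    (many : 2 * ∫⁻ x, ‖η x‖ₑ ^ 2 < regionIntegral (fun _ x => ‖η x‖ₑ ^ 2) (square c ℓ))
    (few : ∀ b, regionIntegral (fun _ x => ‖η x‖ₑ ^ 2) (square (quarterCorner c ℓ b) (ℓ / 2)) ≤
      2 * ∫⁻ x, ‖η x‖ₑ ^ 2) :
    LocalLiebThirring α η c ℓ := by
  have exclusion := hη.fluxGap_mul_lintegral_enorm_sq_le α hℓ many
  have bound := fun b => hη.fluxGap_mul_setLIntegral_density_sq_half_le α _ ℓ (few b)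
  unfold LocalLiebThirring
  rw [regionIntegral_square_eq_sum_quarters hℓ] at exclusion ⊢
  rw [setLIntegral_square_eq_sum_quarters hℓ]
  set m := ∫⁻ x, ‖η x‖ₑ ^ 2
  set a := ENNReal.ofReal (fluxGap α)
  set L := ENNReal.ofReal ℓ
  set R : (Fin 2 → Bool) → ℝ≥0∞ := fun b =>
    ∫⁻ z in square (quarterCorner c ℓ b) (ℓ / 2), density η z ^ 2
  set T : (Fin 2 → Bool) → ℝ≥0∞ := fun b => regionIntegral (fun j x => ‖momentum α j η x‖ₑ ^ 2)
    (square (quarterCorner c ℓ b) (ℓ / 2))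
  calc a * (L ^ 2 * ∑ b, R b + 32 * m ^ 2)
      = ∑ b, a * (L ^ 2 * R b) + 32 * (a * m ^ 2) := by
        rw [← Finset.mul_sum, ← Finset.mul_sum]; ring
    _ ≤ ∑ b, (32 * (a * m ^ 2) + 16 * (L ^ 2 * (m * T b))) + 32 * (a * m ^ 2) :=
        add_le_add_left (Finset.sum_le_sum fun b _ => bound b) _
    _ = 160 * (m * (a * m)) + 16 * (L ^ 2 * (m * ∑ b, T b)) := by
        simp only [Finset.sum_add_distrib, Finset.sum_const, Finset.card_univ, ← Finset.mul_sum,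
          Fintype.card_fun, Fintype.card_bool, Fintype.card_fin, nsmul_eq_mul]
        push_cast
        ring
    _ ≤ 160 * (m * (6 * 256 ^ 4 * (L ^ 2 * ∑ b, T b))) + 16 * (L ^ 2 * (m * ∑ b, T b)) := by
        gcongr
    _ = _ := by ring

theorem IsCore.localLiebThirring (hη : IsCore η) (α : ℝ) (c : Plane) {ℓ : ℝ} (hℓ : 0 < ℓ)
    (many : 2 * ∫⁻ x, ‖η x‖ₑ ^ 2 < regionIntegral (fun _ x => ‖η x‖ₑ ^ 2) (square c ℓ)) :
    LocalLiebThirring α η c ℓ := by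
  obtain ⟨ε, hε, hsep⟩ := hη.exists_separation
  refine square_dyadic_induction (P := fun c ℓ => 2 * ∫⁻ x, ‖η x‖ₑ ^ 2 <
    regionIntegral (fun _ x => ‖η x‖ₑ ^ 2) (square c ℓ) → LocalLiebThirring α η c ℓ) hε ?_ ?_ hℓ c
    many
  · intro c ℓ hℓ many
    have atMostOne := regionIntegral_le_of_separated (measurableSet_square c ℓ)
      fun x hx j k hjk => hsep x hx j k hjk c ℓ hℓ
    exact absurd (many.trans_le atMostOne) (le_mul_of_one_le_left zero_le one_le_two).not_gt
  · intro c ℓ hℓ ih many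
    by_cases hquarter : ∃ b, 2 * ∫⁻ x, ‖η x‖ₑ ^ 2 <
        regionIntegral (fun _ x => ‖η x‖ₑ ^ 2) (square (quarterCorner c ℓ b) (ℓ / 2))
    · obtain ⟨b, hb⟩ := hquarter
      exact hη.localLiebThirring_of_quarter α hℓ ih hb
    · exact hη.localLiebThirring_of_forall_quarter_le α hℓ many (by simpa using hquarter)

theorem IsCore.fluxGap_mul_setLIntegral_density_sq_le (hη : IsCore η) (α : ℝ) (c : Plane) {ℓ : ℝ}
    (hℓ : 0 < ℓ) :
    ENNReal.ofReal (fluxGap α) * ∫⁻ z in square c ℓ, density η z ^ 2 ≤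
      (960 * 256 ^ 4 + 16) * ((∫⁻ x, ‖η x‖ₑ ^ 2) * ∑ j, ∫⁻ x, ‖momentum α j η x‖ₑ ^ 2) +
        8 * (∫⁻ x, ‖η x‖ₑ ^ 2) ^ 2 * (ENNReal.ofReal ℓ ^ 2)⁻¹ := by
  have ha : ENNReal.ofReal (fluxGap α) ≤ 1 := ENNReal.ofReal_le_one.2 (fluxGap_le_one α)
  have hTle := regionIntegral_le (fun j x => ‖momentum α j η x‖ₑ ^ 2) (square c ℓ)
  have local_many := hη.localLiebThirring α c hℓ
  have local_few := hη.sq_mul_setLIntegral_density_sq_le_of_regionIntegral_le α c ℓ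
  unfold LocalLiebThirring at local_many
  set m := ∫⁻ x, ‖η x‖ₑ ^ 2
  set T := ∑ j, ∫⁻ x, ‖momentum α j η x‖ₑ ^ 2
  set a := ENNReal.ofReal (fluxGap α)
  set K : ℝ≥0∞ := 960 * 256 ^ 4 + 16
  set L := ENNReal.ofReal ℓ
  set R := ∫⁻ z in square c ℓ, density η z ^ 2
  have scaled : L ^ 2 * (a * R) ≤ K * (L ^ 2 * (m * T)) + 8 * m ^ 2 := by
    rw [mul_left_comm]
    rcases lt_or_ge (2 * m) (regionIntegral (fun _ x => ‖η x‖ₑ ^ 2) (square c ℓ)) with many | few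
    · calc a * (L ^ 2 * R) ≤ a * (L ^ 2 * R + 32 * m ^ 2) := by gcongr; exact le_self_add
        _ ≤ K * (L ^ 2 * (m * T)) := (local_many many).trans (by gcongr)
        _ ≤ _ := le_self_add
    · calc a * (L ^ 2 * R) ≤ 1 * (8 * m ^ 2 + 16 * (L ^ 2 * (m * T))) :=
            mul_le_mul' ha ((local_few few).trans (by gcongr))
        _ = 16 * (L ^ 2 * (m * T)) + 8 * m ^ 2 := by ring
        _ ≤ _ := by gcongr; exact le_add_self
  have hL0 : L ^ 2 ≠ 0 := by simpa [L] using hℓ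
  have hLtop : L ^ 2 ≠ ⊤ := by finiteness
  rw [← ENNReal.mul_le_mul_iff_right hL0 hLtop]
  refine scaled.trans_eq ?_
  rw [mul_add, mul_left_comm (L ^ 2) (8 * m ^ 2), ENNReal.mul_inv_cancel hL0 hLtop]
  ring

/-- The corner of the `k`-th square of the exhaustion of the plane by the centred squares of side
`2 (k + 1)`. -/
def exhaustionCorner (k : ℕ) : Plane := WithLp.toLp 2 fun _ => -(k + 1 : ℝ)

theorem monotone_exhaustion : Monotone fun k : ℕ => square (exhaustionCorner k) (2 * (k + 1)) := by
  intro k k' hk z hz i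
  have hk' : (k : ℝ) ≤ k' := by exact_mod_cast hk
  have hzi := hz i
  simp only [exhaustionCorner, Set.mem_Ico] at hzi ⊢
  constructor <;> linarith

theorem iUnion_exhaustion : ⋃ k : ℕ, square (exhaustionCorner k) (2 * (k + 1)) = Set.univ := by
  refine Set.eq_univ_of_forall fun z => Set.mem_iUnion.2 ?_
  obtain ⟨k, hk⟩ := exists_nat_gt ‖z‖
  refine ⟨k, fun i => ?_⟩
  have hzi := abs_le.1 (abs_apply_le_norm z i)
  simp only [exhaustionCorner, Set.mem_Ico]
  constructor <;> linarith

theorem mul_lintegral_le_of_forall_square {f : Plane → ℝ≥0∞} {a A B : ℝ≥0∞} (hB : B ≠ ⊤)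
    (h : ∀ c ℓ, 0 < ℓ → a * ∫⁻ z in square c ℓ, f z ≤ A + B * (ENNReal.ofReal ℓ ^ 2)⁻¹) :
    a * ∫⁻ z, f z ≤ A := by
  have hside : Tendsto (fun k : ℕ => ENNReal.ofReal (2 * ((k : ℝ) + 1))) atTop (𝓝 ⊤) :=
    ENNReal.tendsto_ofReal_atTop.comp ((tendsto_atTop_add_const_right _ _
      tendsto_natCast_atTop_atTop).const_mul_atTop two_pos)
  have herror : Tendsto (fun k : ℕ => (ENNReal.ofReal (2 * ((k : ℝ) + 1)) ^ 2)⁻¹) atTop (𝓝 0) := by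
    simpa using tendsto_inv_iff.2 (ENNReal.Tendsto.pow (n := 2) hside)
  have hlim : Tendsto (fun k : ℕ => A + B * (ENNReal.ofReal (2 * ((k : ℝ) + 1)) ^ 2)⁻¹) atTop
      (𝓝 A) := by
    simpa using tendsto_const_nhds.add (ENNReal.Tendsto.const_mul herror (Or.inr hB))
  rw [← setLIntegral_univ, ← iUnion_exhaustion,
    setLIntegral_iUnion_of_directed _ monotone_exhaustion.directed_le, ENNReal.mul_iSup]
  refine iSup_le fun k => ge_of_tendsto hlim ?_
  filter_upwards [eventually_ge_atTop k] with k' hk'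
  exact (mul_le_mul_right (lintegral_mono_set (monotone_exhaustion hk')) _).trans
    (h _ _ (by positivity))

theorem IsCore.lieb_thirring (hη : IsCore η) (α : ℝ) :
    ENNReal.ofReal (fluxGap α) * ∫⁻ z, density η z ^ 2 ≤ (960 * 256 ^ 4 + 16) *
      ((∫⁻ x, ‖η x‖ₑ ^ 2) * ∑ j, ∫⁻ x, ‖momentum α j η x‖ₑ ^ 2) := by
  have hm := hη.lintegral_enorm_sq_ne_top
  exact mul_lintegral_le_of_forall_square (by finiteness) fun c _ hℓ =>
    hη.fluxGap_mul_setLIntegral_density_sq_le α c hℓ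

end LiebThirring

section FormDomain

theorem tendsto_eLpNorm_of_tendsto_eLpNorm_sub {X E ι : Type*} [MeasurableSpace X]
    [NormedAddCommGroup E] {μ : Measure X} {p : ℝ≥0∞} (hp : 1 ≤ p) {l : Filter ι} {f : ι → X → E}
    {g : X → E} (hf : ∀ m, AEStronglyMeasurable (f m) μ) (hg : MemLp g p μ)
    (h : Tendsto (fun m => eLpNorm (f m - g) p μ) l (𝓝 0)) :
    Tendsto (fun m => eLpNorm (f m) p μ) l (𝓝 (eLpNorm g p μ)) := by
  have lower : ∀ m, eLpNorm g p μ - eLpNorm (f m - g) p μ ≤ eLpNorm (f m) p μ := fun m => by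
    rw [tsub_le_iff_right]
    simpa using eLpNorm_sub_le (hf m) ((hf m).sub hg.1) hp
  have upper : ∀ m, eLpNorm (f m) p μ ≤ eLpNorm g p μ + eLpNorm (f m - g) p μ := fun m => by
    simpa using eLpNorm_add_le hg.1 ((hf m).sub hg.1) hp
  refine tendsto_of_tendsto_of_tendsto_of_le_of_le ?_ ?_ lower upper
  · simpa using ENNReal.Tendsto.sub tendsto_const_nhds h (Or.inl hg.2.ne)
  · simpa using tendsto_const_nhds.add h

theorem tendsto_lintegral_enorm_sq {X E ι : Type*} [MeasurableSpace X] [NormedAddCommGroup E]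
    {μ : Measure X} {l : Filter ι} {f : ι → X → E} {g : X → E}
    (hf : ∀ m, AEStronglyMeasurable (f m) μ) (hg : MemLp g 2 μ)
    (h : Tendsto (fun m => eLpNorm (f m - g) 2 μ) l (𝓝 0)) :
    Tendsto (fun m => ∫⁻ x, ‖f m x‖ₑ ^ 2 ∂μ) l (𝓝 (∫⁻ x, ‖g x‖ₑ ^ 2 ∂μ)) := by
  simp only [lintegral_enorm_sq_eq_eLpNorm_sq]
  exact ENNReal.Tendsto.pow (tendsto_eLpNorm_of_tendsto_eLpNorm_sub one_le_two hf hg h)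

theorem IsMomentum.exists_approx_ae {N : ℕ} {α : ℝ} {Ψ : Config N → ℂ}
    {D : Fin N → Config N → EuclideanSpace ℂ (Fin 2)} (h : IsMomentum α Ψ D) :
    ∃ η : ℕ → Config N → ℂ, (∀ m, IsCore (η m)) ∧
      Tendsto (fun m => eLpNorm (η m - Ψ) 2 volume) atTop (𝓝 0) ∧
      (∀ j, Tendsto (fun m => eLpNorm (momentum α j (η m) - D j) 2 volume) atTop (𝓝 0)) ∧
      ∀ᵐ x, Tendsto (fun m => η m x) atTop (𝓝 (Ψ x)) := by
  obtain ⟨η, hη, hΨ, hD⟩ := h.approx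
  have hmeasure := tendstoInMeasure_of_tendsto_eLpNorm two_ne_zero
    (fun m => (hη m).smooth.continuous.aestronglyMeasurable) h.memLp.aestronglyMeasurable hΨ
  obtain ⟨φ, hφ, hae⟩ := hmeasure.exists_seq_tendsto_ae
  exact ⟨fun m => η (φ m), fun m => hη _, hΨ.comp hφ.tendsto_atTop,
    fun j => (hD j).comp hφ.tendsto_atTop, hae⟩

variable {n : ℕ}

theorem measurable_cons (z : Plane) :
    Measurable fun y : Config n => (Fin.cons z y : Config (n + 1)) := by
  simpa only [Function.comp_def, Fin.insertNth_zero'] using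
    (measurePreserving_insertNth (n := n) 0).measurable.comp (measurable_prodMk_left (x := z))

theorem ae_ae_insertNth {P : Config (n + 1) → Prop} (h : ∀ᵐ x, P x) (j : Fin (n + 1)) :
    ∀ᵐ z : Plane, ∀ᵐ y : Config n, P (Fin.insertNth j z y) :=
  Measure.ae_ae_of_ae_prod ((measurePreserving_insertNth j).quasiMeasurePreserving.ae h)

theorem ae_ae_cons {P : Config (n + 1) → Prop} (h : ∀ᵐ x, P x) :
    ∀ᵐ z : Plane, ∀ᵐ y : Config n, P (Fin.cons z y) := by
  simpa only [Fin.insertNth_zero'] using ae_ae_insertNth h 0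

theorem lintegral_density_sq_le_liminf {Ψ : Config (n + 1) → ℂ} {η : ℕ → Config (n + 1) → ℂ}
    (hη : ∀ m, Measurable (η m)) (hae : ∀ᵐ x, Tendsto (fun m => η m x) atTop (𝓝 (Ψ x))) :
    ∫⁻ z, density Ψ z ^ 2 ≤ liminf (fun m => ∫⁻ z, density (η m) z ^ 2) atTop := by
  have pointwise : ∀ᵐ z, density Ψ z ≤ liminf (fun m => density (η m) z) atTop := by
    filter_upwards [ae_ae_cons hae] with z hz
    have hslice : ∀ m, Measurable fun y : Config n =>
        ((n + 1 : ℕ) : ℝ≥0∞) * ‖η m (Fin.cons z y : Config (n + 1))‖ₑ ^ 2 := fun m =>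
      (((hη m).comp (measurable_cons z)).enorm.pow_const 2).const_mul _
    simp only [density, ← lintegral_const_mul' _ _ (ENNReal.natCast_ne_top (n + 1))]
    refine (lintegral_mono_ae ?_).trans (lintegral_liminf_le hslice)
    filter_upwards [hz] with y hy
    exact (ENNReal.Tendsto.const_mul (ENNReal.Tendsto.pow hy.enorm)
      (Or.inr (ENNReal.natCast_ne_top _))).liminf_eq.ge
  refine (lintegral_mono_ae ?_).trans (lintegral_liminf_le fun m =>
    (measurable_density (hη m)).pow_const 2)
  filter_upwards [pointwise] with z hz
  refine (pow_le_pow_left₀ zero_le hz 2).trans_eq ?_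
  exact Monotone.map_liminf_of_continuousAt (fun x y hxy => pow_le_pow_left₀ zero_le hxy 2) _
    (ENNReal.continuous_pow 2).continuousAt

variable {α : ℝ} {Ψ : Config (n + 1) → ℂ}
  {D : Fin (n + 1) → Config (n + 1) → EuclideanSpace ℂ (Fin 2)}

theorem IsMomentum.ae_ae_apply_insertNth (h : IsMomentum α Ψ D) (j : Fin (n + 1)) :
    ∀ᵐ z : Plane, ∀ᵐ y : Config n,
      Ψ (Fin.insertNth j z y) = Ψ (Fin.cons z y : Config (n + 1)) := by
  obtain ⟨η, hη, -, -, hae⟩ := h.exists_approx_ae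
  filter_upwards [ae_ae_insertNth hae j, ae_ae_cons hae] with z hinsert hcons
  filter_upwards [hinsert, hcons] with y hinsert hcons
  simp only [(hη _).apply_insertNth j z y] at hinsert
  exact tendsto_nhds_unique hinsert hcons

theorem IsMomentum.kineticEnergy_ne_top {N : ℕ} {Ψ : Config N → ℂ}
    {D : Fin N → Config N → EuclideanSpace ℂ (Fin 2)} (h : IsMomentum α Ψ D) :
    kineticEnergy D ≠ ⊤ :=
  ENNReal.sum_ne_top.2 fun j _ => lintegral_enorm_sq_ne_top (h.memLp_momentum j)

theorem IsMomentum.lieb_thirring (h : IsMomentum α Ψ D) :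
    ENNReal.ofReal (fluxGap α) * ∫⁻ z, density Ψ z ^ 2 ≤
      (960 * 256 ^ 4 + 16) * ((∫⁻ x, ‖Ψ x‖ₑ ^ 2) * kineticEnergy D) := by
  obtain ⟨η, hη, hΨ, hD, hae⟩ := h.exists_approx_ae
  have hηm : ∀ m, Measurable (η m) := fun m => (hη m).smooth.continuous.measurable
  have mass : Tendsto (fun m => ∫⁻ x, ‖η m x‖ₑ ^ 2) atTop (𝓝 (∫⁻ x, ‖Ψ x‖ₑ ^ 2)) :=
    tendsto_lintegral_enorm_sq (fun m => (hηm m).aestronglyMeasurable) h.memLp hΨ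
  have kinetic : Tendsto (fun m => ∑ j, ∫⁻ x, ‖momentum α j (η m) x‖ₑ ^ 2) atTop
      (𝓝 (kineticEnergy D)) :=
    tendsto_finsetSum _ fun j _ => tendsto_lintegral_enorm_sq
      (fun m => (measurable_momentum (hη m).contDiff_one α j).aestronglyMeasurable)
      (h.memLp_momentum j) (hD j)
  have hlim := ENNReal.Tendsto.const_mul (a := 960 * 256 ^ 4 + 16) (ENNReal.Tendsto.mul mass
    (Or.inr h.kineticEnergy_ne_top) kinetic (Or.inr (lintegral_enorm_sq_ne_top h.memLp)))
    (Or.inr (by finiteness))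
  calc _ ≤ ENNReal.ofReal (fluxGap α) * liminf (fun m => ∫⁻ z, density (η m) z ^ 2) atTop :=
        mul_le_mul_right (lintegral_density_sq_le_liminf hηm hae) _
    _ = liminf (fun m => ENNReal.ofReal (fluxGap α) * ∫⁻ z, density (η m) z ^ 2) atTop :=
        Monotone.map_liminf_of_continuousAt (fun _ _ hxy => mul_le_mul_right hxy _) _
          (ENNReal.continuous_const_mul ENNReal.ofReal_ne_top).continuousAt
    _ ≤ liminf (fun m => (960 * 256 ^ 4 + 16) * ((∫⁻ x, ‖η m x‖ₑ ^ 2) *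
          ∑ j, ∫⁻ x, ‖momentum α j (η m) x‖ₑ ^ 2)) atTop :=
        liminf_le_liminf (Eventually.of_forall fun m => (hη m).lieb_thirring α)
    _ = _ := hlim.liminf_eq

end FormDomain

section PotentialEnergy

theorem mul_le_mul_sq_add_inv_mul_sq {κ : ℝ≥0∞} (hκ : κ ≠ 0) (hκ' : κ ≠ ⊤) (r ρ : ℝ≥0∞) :
    r * ρ ≤ κ * ρ ^ 2 + (4 * κ)⁻¹ * r ^ 2 := by
  have hcancel : (2 : ℝ≥0∞) * 2⁻¹ = 1 := ENNReal.mul_inv_cancel two_ne_zero ENNReal.ofNat_ne_top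
  have hfour : (2⁻¹ : ℝ≥0∞) ^ 2 = 4⁻¹ := by rw [← ENNReal.inv_pow]; norm_num
  have young := two_mul_mul_le_young hκ hκ' (2⁻¹ * r) ρ
  rw [← mul_assoc, ← mul_assoc, hcancel, one_mul, mul_pow, hfour, ← mul_assoc, add_comm] at young
  rwa [ENNReal.mul_inv (Or.inr hκ') (Or.inr hκ), mul_comm 4⁻¹]

theorem ofReal_integral_le_lintegral_ofReal {X : Type*} [MeasurableSpace X] (μ : Measure X)
    (f : X → ℝ) : ENNReal.ofReal (∫ x, f x ∂μ) ≤ ∫⁻ x, ENNReal.ofReal (f x) ∂μ := by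
  by_cases hf : Integrable f μ
  · rw [integral_eq_lintegral_pos_part_sub_lintegral_neg_part hf]
    exact (ENNReal.ofReal_le_ofReal (sub_le_self _ ENNReal.toReal_nonneg)).trans
      ENNReal.ofReal_toReal_le
  · simp [integral_undef hf]

theorem ofReal_sum_mul_norm_sq_le {ι E : Type*} [Fintype ι] [NormedAddCommGroup E] (v : ι → ℝ)
    (e : E) :
    ENNReal.ofReal ((∑ i, v i) * ‖e‖ ^ 2) ≤ ∑ i, ENNReal.ofReal (v i) * ‖e‖ₑ ^ 2 := by
  rw [ENNReal.ofReal_mul' (by positivity), ENNReal.ofReal_pow (norm_nonneg e), ofReal_norm,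
    ← Finset.sum_mul]
  refine mul_le_mul_left ?_ _
  exact Finset.le_sum_of_subadditive _ ENNReal.ofReal_zero.le (fun _ _ => ENNReal.ofReal_add_le) _ _

variable {n : ℕ} {α : ℝ} {Ψ : Config (n + 1) → ℂ}
  {D : Fin (n + 1) → Config (n + 1) → EuclideanSpace ℂ (Fin 2)}

theorem aemeasurable_comp_apply_mul_enorm_sq {N : ℕ} {Ψ : Config N → ℂ}
    (hΨ : AEStronglyMeasurable Ψ) {w : Plane → ℝ≥0∞} (hw : AEMeasurable w) (j : Fin N) :
    AEMeasurable fun x : Config N => w (x j) * ‖Ψ x‖ₑ ^ 2 :=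
  (hw.comp_quasiMeasurePreserving (Measure.quasiMeasurePreserving_eval _ j)).mul
    (hΨ.aemeasurable.enorm.pow_const 2)

theorem IsMomentum.sum_lintegral_mul_eq (h : IsMomentum α Ψ D) {w : Plane → ℝ≥0∞}
    (hw : AEMeasurable w) (hwt : ∀ z, w z ≠ ⊤) :
    ∑ j, ∫⁻ x : Config (n + 1), w (x j) * ‖Ψ x‖ₑ ^ 2 = ∫⁻ z, w z * density Ψ z := by
  have particle : ∀ j, ∫⁻ x : Config (n + 1), w (x j) * ‖Ψ x‖ₑ ^ 2 =
      ∫⁻ z, w z * ∫⁻ y : Config n, ‖Ψ (Fin.cons z y : Config (n + 1))‖ₑ ^ 2 := fun j => by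
    rw [lintegral_insertNth j (aemeasurable_comp_apply_mul_enorm_sq h.memLp.1 hw j)]
    refine lintegral_congr_ae ?_
    filter_upwards [h.ae_ae_apply_insertNth j] with z hz
    rw [← lintegral_const_mul' _ _ (hwt z)]
    refine lintegral_congr_ae ?_
    filter_upwards [hz] with y hy
    rw [hy, Fin.insertNth_apply_same]
  simp only [particle, Finset.sum_const, Finset.card_univ, Fintype.card_fin, nsmul_eq_mul, density]
  rw [← lintegral_const_mul' _ _ (ENNReal.natCast_ne_top _)]
  exact lintegral_congr fun z => mul_left_comm _ _ _

theorem IsMomentum.ofReal_neg_potential_le (h : IsMomentum α Ψ D) {V : Plane → ℝ}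
    (hV : AEMeasurable V) :
    ENNReal.ofReal (-∫ x : Config (n + 1), (∑ j, V (x j)) * ‖Ψ x‖ ^ 2) ≤
      ∫⁻ z, ENNReal.ofReal (-V z) * density Ψ z := by
  have hV' : AEMeasurable fun z => ENNReal.ofReal (-V z) := hV.neg.ennreal_ofReal
  simp only [← integral_neg, ← neg_mul, ← Finset.sum_neg_distrib]
  calc _ ≤ ∫⁻ x : Config (n + 1), ENNReal.ofReal ((∑ j, -V (x j)) * ‖Ψ x‖ ^ 2) :=
        ofReal_integral_le_lintegral_ofReal _ _
    _ ≤ ∫⁻ x : Config (n + 1), ∑ j, ENNReal.ofReal (-V (x j)) * ‖Ψ x‖ₑ ^ 2 :=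
        lintegral_mono fun x => ofReal_sum_mul_norm_sq_le _ _
    _ = ∑ j, ∫⁻ x : Config (n + 1), ENNReal.ofReal (-V (x j)) * ‖Ψ x‖ₑ ^ 2 :=
        lintegral_finsetSum' _ fun j _ => aemeasurable_comp_apply_mul_enorm_sq h.memLp.1 hV' j
    _ = _ := h.sum_lintegral_mul_eq hV' fun _ => ENNReal.ofReal_ne_top

theorem lintegral_mul_le_mul_lintegral_sq_add {X : Type*} [MeasurableSpace X] {μ : Measure X}
    {κ : ℝ≥0∞} (hκ : κ ≠ 0) (hκ' : κ ≠ ⊤) {w : X → ℝ≥0∞} (hw : AEMeasurable w μ)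
    (ρ : X → ℝ≥0∞) :
    ∫⁻ x, w x * ρ x ∂μ ≤ κ * ∫⁻ x, ρ x ^ 2 ∂μ + (4 * κ)⁻¹ * ∫⁻ x, w x ^ 2 ∂μ := by
  rw [← lintegral_const_mul' _ _ hκ', ← lintegral_const_mul'' _ (hw.pow_const 2),
    ← lintegral_add_right' _ ((hw.pow_const 2).const_mul _)]
  exact lintegral_mono fun x => mul_le_mul_sq_add_inv_mul_sq hκ hκ' _ _

theorem neg_coe_le_coe_add_coe {T W : ℝ≥0∞} {I : ℝ} (h : ENNReal.ofReal (-I) ≤ T + W) :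
    -(W : EReal) ≤ T + I := by
  rcases eq_or_ne W ⊤ with rfl | hW
  · simp
  rcases eq_or_ne T ⊤ with rfl | hT
  · simp
  have hreal : -I ≤ T.toReal + W.toReal := by
    rw [← ENNReal.toReal_add hT hW]
    exact (ENNReal.ofReal_le_iff_le_toReal (ENNReal.add_ne_top.2 ⟨hT, hW⟩)).1 h
  rw [← EReal.coe_ennreal_toReal hW, ← EReal.coe_ennreal_toReal hT, ← EReal.coe_neg,
    ← EReal.coe_add, EReal.coe_le_coe_iff]
  linarith

theorem neg_le_groundStateEnergy {κ : ℝ≥0∞} (hκ : κ ≠ 0) (hκ' : κ ≠ ⊤)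
    (hbound : ∀ (Ψ : Config (n + 1) → ℂ)
      (D : Fin (n + 1) → Config (n + 1) → EuclideanSpace ℂ (Fin 2)),
      IsMomentum α Ψ D → eLpNorm Ψ 2 volume = 1 → κ * ∫⁻ z, density Ψ z ^ 2 ≤ kineticEnergy D)
    {V : Plane → ℝ} (hV : AEMeasurable V) :
    -(((4 * κ)⁻¹ * ∫⁻ z, ENNReal.ofReal (-V z) ^ 2 : ℝ≥0∞) : EReal) ≤
      groundStateEnergy α (n + 1) V := by
  refine le_sInf ?_
  rintro _ ⟨Ψ, D, h, hΨ, -, rfl⟩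
  refine neg_coe_le_coe_add_coe ((h.ofReal_neg_potential_le hV).trans ?_)
  exact (lintegral_mul_le_mul_lintegral_sq_add hκ hκ' hV.neg.ennreal_ofReal _).trans
    (add_le_add_left (hbound Ψ D h hΨ) _)

theorem IsMomentum.lieb_thirring_of_eLpNorm_eq_one (h : IsMomentum α Ψ D)
    (hΨ : eLpNorm Ψ 2 volume = 1) :
    ENNReal.ofReal ((960 * 256 ^ 4 + 16)⁻¹ * fluxGap α) * ∫⁻ z, density Ψ z ^ 2 ≤
      kineticEnergy D := by
  have hconst : ENNReal.ofReal (960 * 256 ^ 4 + 16)⁻¹ = (960 * 256 ^ 4 + 16)⁻¹ := by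
    rw [ENNReal.ofReal_inv_of_pos (by norm_num)]
    norm_num
  have lieb_thirring := h.lieb_thirring
  rw [lintegral_enorm_sq_eq_eLpNorm_sq, hΨ, one_pow, one_mul] at lieb_thirring
  rw [ENNReal.ofReal_mul (by positivity), hconst, mul_assoc, ENNReal.inv_mul_le_iff (by simp)
    (by finiteness)]
  exact lieb_thirring

end PotentialEnergy

end Anyon

end

theorem theorem2_general :
    ∃ C : ℝ, 0 < C ∧
      (∀ (α : ℝ) (n : ℕ) (Ψ : Anyon.Config (n + 1) → ℂ)
        (D : Fin (n + 1) → Anyon.Config (n + 1) → EuclideanSpace ℂ (Fin 2)),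
        Anyon.IsMomentum α Ψ D → eLpNorm Ψ 2 volume = 1 →
        ENNReal.ofReal (C * Anyon.fluxGap α) * ∫⁻ x, Anyon.density Ψ x ^ 2 ≤
          Anyon.kineticEnergy D) ∧
      (∀ α : ℝ, 0 < Anyon.fluxGap α → ∀ (N : ℕ), 1 ≤ N →
        ∀ V : Anyon.Plane → ℝ, AEMeasurable V volume →
        -((ENNReal.ofReal (1 / (4 * C * Anyon.fluxGap α)) *
            ∫⁻ x, ENNReal.ofReal (max (-V x) 0 ^ 2) : ℝ≥0∞) : EReal) ≤
          Anyon.groundStateEnergy α N V) := by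
  refine ⟨(960 * 256 ^ 4 + 16)⁻¹, by positivity,
    fun α n Ψ D h hΨ => h.lieb_thirring_of_eLpNorm_eq_one hΨ, fun α hα N hN V hV => ?_⟩
  obtain ⟨n, rfl⟩ := Nat.exists_eq_add_of_le' hN
  set κ : ℝ := (960 * 256 ^ 4 + 16)⁻¹ * Anyon.fluxGap α
  have hκ : 0 < κ := by positivity
  have hconst : ENNReal.ofReal (1 / (4 * (960 * 256 ^ 4 + 16)⁻¹ * Anyon.fluxGap α)) =
      (4 * ENNReal.ofReal κ)⁻¹ := by
    rw [mul_assoc, one_div, ENNReal.ofReal_inv_of_pos (by positivity),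
      ENNReal.ofReal_mul zero_le_four, ENNReal.ofReal_ofNat]
  have hneg : ∀ x, ENNReal.ofReal (max (-V x) 0 ^ 2) = ENNReal.ofReal (-V x) ^ 2 := fun x => by
    rw [ENNReal.ofReal_pow (le_max_right _ _), ENNReal.ofReal_max, ENNReal.ofReal_zero,
      max_eq_left zero_le]
  simp only [hconst, hneg]
  exact Anyon.neg_le_groundStateEnergy (by simpa using hκ) ENNReal.ofReal_ne_top
    (fun Ψ D h hΨ => h.lieb_thirring_of_eLpNorm_eq_one hΨ) hV

theorem theorem2 :
    ∃ C : ℝ, 0 < C ∧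
      (∀ α : ℝ, 0 ≤ α → α ≤ 1 → ∀ (n : ℕ) (Ψ : Anyon.Config (n + 1) → ℂ)
        (D : Fin (n + 1) → Anyon.Config (n + 1) → EuclideanSpace ℂ (Fin 2)),
        Anyon.IsMomentum α Ψ D → eLpNorm Ψ 2 volume = 1 →
        ENNReal.ofReal (C * α) * ∫⁻ x, Anyon.density Ψ x ^ 2 ≤ Anyon.kineticEnergy D) ∧
      (∀ α : ℝ, 0 < α → α ≤ 1 → ∀ (N : ℕ), 1 ≤ N →
        ∀ V : Anyon.Plane → ℝ, AEMeasurable V volume →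
        -((ENNReal.ofReal (1 / (4 * C * α)) *
            ∫⁻ x, ENNReal.ofReal (max (-V x) 0 ^ 2) : ℝ≥0∞) : EReal) ≤
          Anyon.groundStateEnergy α N V) := by
  obtain ⟨C, hC, density_bound, energy_bound⟩ := theorem2_general
  refine ⟨C, hC, fun α h0 h1 => ?_, fun α h0 h1 => ?_⟩
  · simpa only [Anyon.fluxGap_of_mem_Icc ⟨h0, h1⟩] using density_bound α
  · simpa only [Anyon.fluxGap_of_mem_Icc ⟨h0.le, h1⟩, h0, forall_const] using energy_bound α
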